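/- For every $\varepsilon>0$ there is a constant $C_\varepsilon$, and for every $n$ a number of samples $k_n\le C_\varepsilon\log^4 n$, such that the following holds for every matroid $\mathcal M$ with ground set $[n]$ and family of independent sets $\mathcal I$. There is a randomized online algorithm that knows $\mathcal M$ and is $(\frac14-\varepsilon)$-competitive for the prophet inequality with feasibility constraint $\mathcal I$, using $k_n$ samples from each value distribution. That is: the algorithm does not know the distributions $D_1,\dots,D_n$ on $[0,\infty)$, but is given in advance $k_n$ independent samples from each $D_i$. Then items $1,\dots,n$ arrive in this order, with values $v_i\sim D_i$ that are independent of each other, of the samples and of the internal randomness of the algorithm. When item $i$ arrives, $v_i$ is revealed, and the algorithm decides irrevocably, based on its internal randomness, the samples and $v_1,\dots,v_i$ only, whether to include $i$ in its output $A$; always $A\in\mathcal I$. For all distributions $D_1,\dots,D_n$ on $[0,\infty)$, $$\mathbb E\Big[\sum_{i\in A}v_i\Big]\ \ge\ \Big(\frac14-\varepsilon\Big)\,\mathbb E\Big[\max_{S\in\mathcal I}\sum_{i\in S}v_i\Big],$$ where the expectations (in $[0,\infty]$) are over the values, the samples and the internal randomness of the algorithm. (If $\varepsilon\ge\frac14$,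 the inequality is trivial.) -/

import Mathlib

open MeasureTheory
open scoped NNReal ENNReal

/-- A randomized online algorithm for `n` items arriving in the order `0, 1, …, n - 1`, subject to
the feasibility constraint `F`, which is given `k` samples from each (unknown) value distribution.
The input of the algorithm consists of
* its internal randomness, a point of the probability space `(Seed, law)`;
* the samples, `s t i` being the `t`-th sample of the value of item `i`;
* the values `v i` of the items, revealed one by one. -/
structure SampleOnlineAlgorithm (n k : ℕ) (F : Set (Finset (Fin n))) where
  /-- the space of the internal randomness -/
  Seed : Type
  [measurableSpaceSeed : MeasurableSpace Seed]
  /-- the distribution of the internal randomness -/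
  law : Measure Seed
  [isProbabilityMeasure_law : IsProbabilityMeasure law]
  /-- the decision whether to take item `i` -/
  accept : Fin n → Seed → (Fin k → Fin n → ℝ≥0) → (Fin n → ℝ≥0) → Bool
  measurable_accept : ∀ i, Measurable
    fun x : Seed × (Fin k → Fin n → ℝ≥0) × (Fin n → ℝ≥0) => accept i x.1 x.2.1 x.2.2
  /-- the decision on item `i` is made when only the values of the items `j ≤ i` are revealed -/
  online : ∀ i r s v w, (∀ j ≤ i, v j = w j) → accept i r s v = accept i r s w
  /-- the set of the items taken is always feasible -/
  feasible : ∀ r s v, (Finset.univ.filter fun i => accept i r s v = true) ∈ F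

namespace SampleOnlineAlgorithm

attribute [instance] measurableSpaceSeed isProbabilityMeasure_law

variable {n k : ℕ} {F : Set (Finset (Fin n))}

/-- The set of the items taken by the algorithm. -/
def output (A : SampleOnlineAlgorithm n k F) (r : A.Seed) (s : Fin k → Fin n → ℝ≥0)
    (v : Fin n → ℝ≥0) : Finset (Fin n) :=
  Finset.univ.filter fun i => A.accept i r s v = true

/-- The expected total value of the items taken by the algorithm, when item `i` has the value
distribution `D i`. The internal randomness, all the samples and all the values are independent. -/
noncomputable def expectedValue (A : SampleOnlineAlgorithm n k F) (D : Fin n → Measure ℝ≥0) :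
    ℝ≥0∞ :=
  ∫⁻ x : A.Seed × (Fin k → Fin n → ℝ≥0) × (Fin n → ℝ≥0),
    ∑ i ∈ A.output x.1 x.2.1 x.2.2, (x.2.2 i : ℝ≥0∞)
    ∂(A.law.prod ((Measure.pi fun _ : Fin k => Measure.pi D).prod (Measure.pi D)))

end SampleOnlineAlgorithm

/-- The expected value of the prophet, `E[max_{S ∈ F} ∑_{i ∈ S} v_i]` for independent `v_i ∼ D i`. -/
noncomputable def prophetValue {n : ℕ} (F : Set (Finset (Fin n))) (D : Fin n → Measure ℝ≥0) :
    ℝ≥0∞ :=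
  ∫⁻ v : Fin n → ℝ≥0, (⨆ S ∈ F, ∑ i ∈ S, (v i : ℝ≥0∞)) ∂(Measure.pi D)

/-- The algorithm is `c`-competitive: for all value distributions, its expected value is at least
`c` times that of the prophet. -/
def SampleOnlineAlgorithm.IsCompetitive {n k : ℕ} {F : Set (Finset (Fin n))}
    (A : SampleOnlineAlgorithm n k F) (c : ℝ) : Prop :=
  ∀ D : Fin n → Measure ℝ≥0, (∀ i, IsProbabilityMeasure (D i)) →
    ENNReal.ofReal c * prophetValue F D ≤ A.expectedValue D

/-- The family of the independent sets of a matroid on `Fin n`. -/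
def Matroid.indepFamily {n : ℕ} (M : Matroid (Fin n)) : Set (Finset (Fin n)) :=
  {S | M.Indep (S : Set (Fin n))}

/-! Two losses of a factor of about 1/2 produce the constant 1/4. The prophet's set can be taken to
be the greedy basis (`sum_le_sum_greedy`). The samples yield a test applied to each item separately.
The items that pass are thinned by a fair coin to the active items (first half), and online
contention resolution keeps an active item with probability close to 1/2 (second half).

The test: split the items at random into `k` groups, and let an item compete only with items of
other groups, using a sampled vector reserved for its own group. With less competition it passes at
least as often as it is in the greedy basis (`lintegral_greedy_le_passes`). Conversely, a set of
rank `r` has on average at most `r / (k - 1)` passing items per group: in order of preference, an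
item not spanned by the preferred items outside the group is `k - 1` times as likely to raise the
rank of those items as to be counted (`lintegral_marked_pow_le` is the exponential form). Averaging
over `m = O(log n)` such blocks, with a Chernoff and a union bound, the passing probabilities in
every set sum to at most `1 + δ` times its rank (`measure_not_wellSpread_le`), hence those of
activity to at most `(1 + δ) / 2` times the rank.

Contention resolution: build a decreasing chain of ground sets, the next set growing from `∅` by
adding items of the present one that are spanned with probability above `θ`, slightly more than 1/2,
by what has been added and the other active items of the present set. A rank potential
(`expected_rank_insert`) shows that ranks shrink geometrically, so `L = O(log n)` layers exhaust all
nonloops (`exists_layer`). In its layer an item is blocked with probability at most about `θ`,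
independently of its own value.

The probabilities of being spanned are estimated from `T = O(log n)` fresh vectors in each round.
Growth is not run to stability: it stops at a uniformly random one of `J = O(log n)` rounds, and the
items about to enter are dropped. An item enters only once, so a layer drops it with probability at
most `1 / J` (`measure_dropped_le`). In all `m * k + L * J * T = O(log³ n)` samples are used. -/

/-! ### Product measures: resampling and mixing coordinates. -/

section PiMeasure

variable {ι : Type*} [Fintype ι] {X : ι → Type*} [∀ i, MeasurableSpace (X i)]
  (μ : ∀ i, Measure (X i)) [∀ i, IsProbabilityMeasure (μ i)]

/-- Resampling one coordinate does not change an integral over a product space. -/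
theorem lintegral_pi_update [DecidableEq ι] (i : ι) {f : (∀ i, X i) → ℝ≥0∞} (hf : Measurable f) :
    ∫⁻ ω, f ω ∂Measure.pi μ = ∫⁻ ω, ∫⁻ x, f (Function.update ω i x) ∂μ i ∂Measure.pi μ := by
  have hm : Measurable (∫⋯∫⁻_{i}, f ∂μ) := hf.lmarginal μ
  have : ∫⁻ ω, f ω ∂Measure.pi μ = ∫⁻ ω, (∫⋯∫⁻_{i}, f ∂μ) ω ∂Measure.pi μ := by
    refine lintegral_eq_of_lmarginal_eq {i} hf hm ?_
    funext ω
    rw [lmarginal_singleton (∫⋯∫⁻_{i}, f ∂μ)]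
    simp [lmarginal_update_of_mem]
  rw [this, lmarginal_singleton]

/-- If every section of a set in the direction of one coordinate is small, so is the set. -/
theorem measure_pi_le_of_section_le [DecidableEq ι] (i : ι) {B : Set (∀ i, X i)}
    (hB : MeasurableSet B) {p : ℝ≥0∞} (h : ∀ ω, μ i {x | Function.update ω i x ∈ B} ≤ p) :
    Measure.pi μ B ≤ p := by
  rw [← lintegral_indicator_one hB, lintegral_pi_update μ i (measurable_one.indicator hB)]
  refine (lintegral_mono fun ω => ?_).trans (by simp : ∫⁻ _, p ∂Measure.pi μ ≤ p)
  have hm : MeasurableSet {x | Function.update ω i x ∈ B} :=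
    (measurable_update ω) hB
  refine le_trans (le_of_eq ?_) (h ω)
  rw [← lintegral_indicator_one hm]
  rfl

/-- Choosing some coordinates from one vector and the others from an independent copy gives the
same distribution. -/
theorem measurePreserving_pi_mix (A : Set ι) [DecidablePred (· ∈ A)] :
    MeasurePreserving (fun p : (∀ i, X i) × (∀ i, X i) => fun j => if j ∈ A then p.2 j else p.1 j)
      ((Measure.pi μ).prod (Measure.pi μ)) (Measure.pi μ) := by
  have hmeas : Measurable
      (fun p : (∀ i, X i) × (∀ i, X i) => fun j => if j ∈ A then p.2 j else p.1 j) := by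
    refine measurable_pi_lambda _ fun j => ?_
    by_cases h : j ∈ A
    · simp only [h, if_true]; fun_prop
    · simp only [h, if_false]; fun_prop
  refine ⟨hmeas, (Measure.pi_eq fun s hs => ?_).symm⟩
  rw [Measure.map_apply hmeas (MeasurableSet.univ_pi hs)]
  have : (fun p : (∀ i, X i) × (∀ i, X i) => fun j => if j ∈ A then p.2 j else p.1 j) ⁻¹'
      (Set.univ.pi s) = (Set.univ.pi fun j => if j ∈ A then Set.univ else s j) ×ˢ
        (Set.univ.pi fun j => if j ∈ A then s j else Set.univ) := by
    ext p
    simp only [Set.mem_preimage, Set.mem_pi, Set.mem_univ, true_implies, Set.mem_prod]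
    constructor
    · intro h
      refine ⟨fun j => ?_, fun j => ?_⟩ <;> have := h j <;> by_cases hj : j ∈ A <;> simp_all
    · rintro ⟨h1, h2⟩ j
      have := h1 j
      have := h2 j
      by_cases hj : j ∈ A <;> simp_all
  rw [this, Measure.prod_prod, Measure.pi_pi, Measure.pi_pi, ← Finset.prod_mul_distrib]
  refine Finset.prod_congr rfl fun j _ => ?_
  by_cases hj : j ∈ A <;> simp [hj]

theorem lintegral_pi_mix (A : Set ι) [DecidablePred (· ∈ A)] {f : (∀ i, X i) → ℝ≥0∞}
    (hf : Measurable f) :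
    ∫⁻ s, ∫⁻ v, f (fun j => if j ∈ A then v j else s j) ∂Measure.pi μ ∂Measure.pi μ =
      ∫⁻ u, f u ∂Measure.pi μ := by
  have h := measurePreserving_pi_mix μ A
  rw [← h.lintegral_comp hf]
  exact (lintegral_prod _ (hf.comp h.measurable).aemeasurable).symm

/-- A function of one coordinate is independent of a function of the others. -/
theorem lintegral_pi_mul_of_update [DecidableEq ι] (i : ι) {f : X i → ℝ≥0∞}
    {g : (∀ i, X i) → ℝ≥0∞} (hf : Measurable f) (hg : Measurable g)
    (h : ∀ ω x, g (Function.update ω i x) = g ω) :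
    ∫⁻ ω, f (ω i) * g ω ∂Measure.pi μ = (∫⁻ x, f x ∂μ i) * ∫⁻ ω, g ω ∂Measure.pi μ := by
  rw [lintegral_pi_update μ i (by fun_prop)]
  simp only [Function.update_self, h]
  simp_rw [lintegral_mul_const _ hf]
  rw [lintegral_const_mul _ hg]

end PiMeasure

theorem measurePreserving_curry {ι κ X : Type*} [Fintype ι] [Fintype κ] [MeasurableSpace X]
    (μ : ι → κ → Measure X) [∀ i j, IsProbabilityMeasure (μ i j)] :
    MeasurePreserving (MeasurableEquiv.curry ι κ X) (Measure.pi fun p : ι × κ => μ p.1 p.2)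
      (Measure.pi fun i => Measure.pi fun j => μ i j) := by
  refine ⟨(MeasurableEquiv.curry ι κ X).measurable, ?_⟩
  have := Measure.infinitePi_map_curry (ι := ι) (κ := κ) (X := X) μ
  simpa only [Measure.infinitePi_eq_pi] using this

theorem lintegral_pi_prod {ι : Type*} [Fintype ι] {X : ι → Type*} [∀ i, MeasurableSpace (X i)]
    (μ : ∀ i, Measure (X i)) [∀ i, IsProbabilityMeasure (μ i)] {f : ∀ i, X i → ℝ≥0∞}
    (hf : ∀ i, Measurable (f i)) :
    ∫⁻ ω, ∏ i, f i (ω i) ∂Measure.pi μ = ∏ i, ∫⁻ x, f i x ∂μ i := by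
  have h := ProbabilityTheory.lintegral_prod_eq_prod_lintegral_of_indepFun (μ := Measure.pi μ)
    Finset.univ (fun i ω => f i (ω i))
    (ProbabilityTheory.iIndepFun_pi (X := fun i => f i) fun i => (hf i).aemeasurable)
    (fun i => by fun_prop)
  rw [h]
  refine Finset.prod_congr rfl fun i _ => ?_
  exact (measurePreserving_eval μ i).lintegral_comp (hf i)

/-! ### Measurability of random finite sets. -/

section DiscreteMeasurability

/-- A map into finite sets is measurable as soon as every membership event is. -/
theorem measurable_finset_of_mem {Ω α : Type*} [MeasurableSpace Ω] [Fintype α] [DecidableEq α]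
    [MeasurableSpace (Finset α)] [DiscreteMeasurableSpace (Finset α)] {f : Ω → Finset α}
    (h : ∀ a, MeasurableSet {x | a ∈ f x}) : Measurable f := by
  refine measurable_to_countable' fun S => ?_
  have : f ⁻¹' {S} = ⋂ a, {x | a ∈ f x ↔ a ∈ S} := by
    ext x; simp [Finset.ext_iff]
  rw [this]
  refine MeasurableSet.iInter fun a => ?_
  by_cases ha : a ∈ S
  · simpa only [ha, iff_true] using h a
  · convert (h a).compl using 1
    ext x
    simp [ha]

end DiscreteMeasurability

/-! ### Integer-valued rank in a finite matroid. -/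

section MatroidRank

namespace Matroid

variable {α : Type*} {M : Matroid α} {X Y : Set α} {e : α}

/-- The rank of a set in a finite matroid, as a natural number. -/
noncomputable def natRk (M : Matroid α) (X : Set α) : ℕ := (M.eRk X).toNat

theorem eRk_ne_top_of_finite [Finite α] (M : Matroid α) (X : Set α) : M.eRk X ≠ ⊤ :=
  eRk_ne_top_iff.2 (M.isRkFinite_set X)

theorem natRk_mono [Finite α] (M : Matroid α) (h : X ⊆ Y) : M.natRk X ≤ M.natRk Y :=
  ENat.toNat_le_toNat (M.eRk_mono h) (M.eRk_ne_top_of_finite Y)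

theorem natRk_empty (M : Matroid α) : M.natRk ∅ = 0 := by simp [natRk]

theorem natRk_closure (M : Matroid α) (X : Set α) : M.natRk (M.closure X) = M.natRk X := by
  simp [natRk]

theorem natRk_insert_of_mem (h : e ∈ M.closure X) : M.natRk (insert e X) = M.natRk X := by
  rw [← natRk_closure, closure_insert_eq_of_mem_closure h, natRk_closure]

theorem natRk_insert_of_notMem [Finite α] (he : e ∈ M.E) (h : e ∉ M.closure X) :
    M.natRk (insert e X) = M.natRk X + 1 := by
  rw [natRk, eRk_insert_eq_add_one ⟨he, h⟩, ENat.toNat_add (M.eRk_ne_top_of_finite X) (by simp)]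
  rfl

theorem natRk_le_ncard [Finite α] (M : Matroid α) (X : Set α) : M.natRk X ≤ X.ncard := by
  rw [natRk, Set.ncard_def]
  exact ENat.toNat_le_toNat (M.eRk_le_encard X) (by simpa using X.toFinite)

theorem Indep.natRk_eq (h : M.Indep X) : M.natRk X = X.ncard := by
  rw [natRk, h.eRk_eq_encard, Set.ncard_def]

theorem Indep.natRk_eq_card {S : Finset α} (h : M.Indep (S : Set α)) :
    M.natRk (S : Set α) = S.card := by
  rw [h.natRk_eq, Set.ncard_coe_finset]

/-- Every set lies in the closure of an independent set of the same rank. -/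
theorem exists_indep_subset_closure [Finite α] (hE : M.E = Set.univ) (X : Set α) :
    ∃ I : Finset α, M.Indep (I : Set α) ∧ X ⊆ M.closure (I : Set α) ∧ I.card = M.natRk X := by
  obtain ⟨I, hI⟩ := M.exists_isBasis X (by simp [hE])
  refine ⟨I.toFinite.toFinset, by simpa using hI.indep, by simpa using hI.subset_closure, ?_⟩
  rw [← Indep.natRk_eq_card (M := M) (by simpa using hI.indep)]
  simp [natRk, hI.eRk_eq_eRk]

theorem notMem_of_natRk_eq_zero [Finite α] (hE : M.E = Set.univ) (h : M.natRk X = 0)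
    (he : e ∉ M.closure ∅) : e ∉ X := by
  intro heX
  have h1 := M.natRk_mono (Set.singleton_subset_iff.2 heX)
  rw [← insert_empty_eq, natRk_insert_of_notMem (by simp [hE]) he, natRk_empty] at h1
  omega

end Matroid

end MatroidRank

/-! ### The greedy basis: optimality and the random marking estimate. -/

section Greedy

variable {α β : Type*}

/-- The key by which the relation `Beats` sorts the items. -/
def beatsKey (u : α → β) (i : α) : βᵒᵈ ×ₗ α := toLex (OrderDual.toDual (u i), i)

theorem beatsKey_injective (u : α → β) : Function.Injective (beatsKey u) := by
  intro i j h
  have := congrArg (fun x => (ofLex x).2) h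
  simpa [beatsKey] using this

variable [LinearOrder α] [LinearOrder β]

/-- An item `j` of value `x` is preferred to an item `i` of value `y`: larger values come first,
ties are broken in favour of the smaller item. -/
def Beats (x : β) (j : α) (y : β) (i : α) : Prop := y < x ∨ (x = y ∧ j < i)

theorem beats_irrefl (x : β) (i : α) : ¬ Beats x i x i := by simp [Beats]

theorem beatsKey_lt {u : α → β} {i j : α} :
    beatsKey u j < beatsKey u i ↔ Beats (u j) j (u i) i := by
  simp [beatsKey, Prod.Lex.toLex_lt_toLex, Beats]

theorem Beats.asymm {u : α → β} {i j : α} (h : Beats (u j) j (u i) i) :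
    ¬ Beats (u i) i (u j) j := by
  rw [← beatsKey_lt] at h ⊢
  exact h.asymm

/-- Induction over a finite set of items, sorted by preference. -/
theorem induction_on_beats (u : α → β) {p : Finset α → Prop} (P : Finset α)
    (empty : p ∅)
    (insert : ∀ a s, a ∉ s → (∀ j ∈ s, Beats (u j) j (u a) a) → p s → p (insert a s)) : p P := by
  refine Finset.induction_on_max_value (beatsKey u) P empty fun a s ha h hs => ?_
  refine insert a s ha (fun j hj => ?_) hs
  rw [← beatsKey_lt]
  exact lt_of_le_of_ne (h j hj) fun e => ha (beatsKey_injective u e ▸ hj)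

/-- The greedy basis: the items which are not spanned by the preferred ones. -/
def greedy (M : Matroid α) (u : α → β) : Set α :=
  {i | i ∉ M.closure {j | Beats (u j) j (u i) i}}

-- Abel summation in the form of an induction along the preference order. The term with the weight
-- floor `c` credits the rank of `P` not used by `S`; at `c = 0` and `P` everything it disappears,
-- but the induction needs it.
open scoped Classical in
theorem sum_le_sum_greedy_aux [Finite α] {M : Matroid α} (hE : M.E = Set.univ)
    (u : α → β) (w : α → ℝ) (hw : ∀ i j, u i ≤ u j → w i ≤ w j) {S : Finset α}
    (hS : M.Indep (S : Set α)) (P : Finset α) :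
    ∀ c : ℝ, 0 ≤ c → (∀ i ∈ P, c ≤ w i) →
      ∑ i ∈ P with i ∈ S, w i + c * ((M.natRk P : ℝ) - (P.filter (· ∈ S)).card) ≤
        ∑ i ∈ P with i ∉ M.closure {j | j ∈ P ∧ Beats (u j) j (u i) i}, w i := by
  classical
  induction P using induction_on_beats u with
  | empty => intro c _ _; simp [Matroid.natRk_empty]
  | insert a P ha hP ih =>
    intro c hc hcP
    have hca : c ≤ w a := hcP a (Finset.mem_insert_self a P)
    have hwP : ∀ i ∈ P, w a ≤ w i := fun i hi => hw _ _ (by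
      rcases hP i hi with h | h
      · exact h.le
      · exact h.1.ge)
    -- All earlier items weigh at least `w a`, so the floor can be raised to `w a`; `hd` below is
    -- what remains on returning to the floor `c`.
    have key := ih (w a) (hc.trans hca) hwP
    have hrk : ((P.filter (· ∈ S)).card : ℝ) ≤ M.natRk P := by
      have h1 : M.Indep ((P.filter (· ∈ S) : Finset α) : Set α) :=
        hS.subset (by intro x; simp)
      rw [← h1.natRk_eq_card]
      exact_mod_cast M.natRk_mono (by intro x; simp +contextual)
    have hset : ∀ i ∈ P, {j | j ∈ insert a P ∧ Beats (u j) j (u i) i} =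
        {j | j ∈ P ∧ Beats (u j) j (u i) i} := by
      intro i hi
      ext j
      simp only [Finset.mem_insert, Set.mem_ofPred_eq, and_congr_left_iff, or_iff_right_iff_imp]
      rintro h rfl
      exact absurd (hP i hi) h.asymm
    have hseta : {j | j ∈ insert a P ∧ Beats (u j) j (u a) a} = (P : Set α) := by
      ext j
      simp only [Finset.mem_insert, Set.mem_ofPred_eq, Finset.mem_coe]
      constructor
      · rintro ⟨rfl | h, hb⟩
        · exact absurd hb (beats_irrefl _ _)
        · exact h
      · exact fun h => ⟨Or.inr h, hP j h⟩
    have hfil : (P.filter fun i => i ∉ M.closure {j | j ∈ insert a P ∧ Beats (u j) j (u i) i}) =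
        P.filter fun i => i ∉ M.closure {j | j ∈ P ∧ Beats (u j) j (u i) i} :=
      Finset.filter_congr fun i hi => by rw [hset i hi]
    have hnf : ∀ q : α → Prop, [DecidablePred q] → a ∉ P.filter q := fun q _ h =>
      ha (Finset.mem_filter.1 h).1
    have haE : a ∈ M.E := by simp [hE]
    rw [Finset.filter_insert, Finset.filter_insert, hseta, hfil, Finset.coe_insert]
    have hd : 0 ≤ (w a - c) * ((M.natRk P : ℝ) - (P.filter (· ∈ S)).card) :=
      mul_nonneg (by linarith) (by linarith)
    by_cases hcl : a ∈ M.closure (P : Set α)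
    · rw [Matroid.natRk_insert_of_mem hcl]
      simp only [hcl, not_true_eq_false, if_false]
      by_cases haS : a ∈ S
      · simp only [haS, if_true]
        rw [Finset.sum_insert (hnf _), Finset.card_insert_of_notMem (hnf _)]
        have h2 : ((P.filter (· ∈ S)).card : ℝ) + 1 ≤ M.natRk P := by
          have h1 : M.Indep ((insert a (P.filter (· ∈ S)) : Finset α) : Set α) :=
            hS.subset (by intro x; simp; rintro (rfl | h); exacts [haS, h.2])
          have h3 := h1.natRk_eq_card
          rw [Finset.card_insert_of_notMem (hnf _)] at h3
          have h4 := M.natRk_mono (X := ((insert a (P.filter (· ∈ S)) : Finset α) : Set α))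
            (Y := insert a (P : Set α)) (by intro x; simp; tauto)
          rw [Matroid.natRk_insert_of_mem hcl, h3] at h4
          exact_mod_cast h4
        push_cast
        nlinarith
      · simp only [haS, if_false]
        nlinarith
    · rw [Matroid.natRk_insert_of_notMem haE hcl]
      simp only [hcl, not_false_eq_true, if_true]
      rw [Finset.sum_insert (hnf _)]
      by_cases haS : a ∈ S
      · simp only [haS, if_true]
        rw [Finset.sum_insert (hnf _), Finset.card_insert_of_notMem (hnf _)]
        push_cast
        nlinarith
      · simp only [haS, if_false]
        push_cast
        nlinarith

open scoped Classical in
/-- The greedy basis has the largest weight among the independent sets. -/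
theorem sum_le_sum_greedy [Fintype α] {M : Matroid α} (hE : M.E = Set.univ) (u : α → β)
    (w : α → ℝ) (hw0 : ∀ i, 0 ≤ w i) (hw : ∀ i j, u i ≤ u j → w i ≤ w j) {S : Finset α}
    (hS : M.Indep (S : Set α)) :
    ∑ i ∈ S, w i ≤ ∑ i with i ∈ greedy M u, w i := by
  have h := sum_le_sum_greedy_aux hE u w hw hS Finset.univ 0 le_rfl fun i _ => hw0 i
  simp only [Finset.mem_univ, true_and, zero_mul, add_zero, Finset.filter_univ_mem] at h
  refine h.trans (le_of_eq ?_)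
  congr 1
  ext i
  simp only [Finset.mem_filter, Finset.mem_univ, true_and]
  rfl

open scoped Classical in
/-- Label the items independently, so that an item is marked with probability `γ A`. The number of
marked items not spanned by preferred unmarked ones is controlled by the rank of the unmarked
ones. -/
theorem lintegral_marked_pow_le [Fintype α] {M : Matroid α} (hE : M.E = Set.univ) (u : α → β)
    {K : Type*} [Finite K] [MeasurableSpace K] [DiscreteMeasurableSpace K] (γ : Measure K)
    [IsProbabilityMeasure γ] (A : Set K) (a b : ℝ≥0∞)
    (hab : γ A * a + γ Aᶜ * b ≤ 1) (P : Finset α) :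
    ∫⁻ G : α → K, a ^ (P.filter fun i =>
        G i ∈ A ∧ i ∉ M.closure {j | j ∈ P ∧ G j ∉ A ∧ Beats (u j) j (u i) i}).card *
      b ^ M.natRk {j | j ∈ P ∧ G j ∉ A} ∂Measure.pi (fun _ => γ) ≤ 1 := by
  induction P using induction_on_beats u with
  | empty => simp [Matroid.natRk_empty]
  | insert e P he hP ih =>
    refine le_trans ?_ ih
    -- The item `e` is the least preferred, so its label does not affect the status of the items of
    -- `P`. Integrating out this label alone shows that the quantity is a supermartingale.
    rw [lintegral_pi_update (fun _ => γ) e (Measurable.of_discrete)]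
    refine lintegral_mono fun G => ?_
    set B : Set α := {j | j ∈ P ∧ G j ∉ A} with hB
    set Z := (P.filter fun i =>
        G i ∈ A ∧ i ∉ M.closure {j | j ∈ P ∧ G j ∉ A ∧ Beats (u j) j (u i) i}) with hZ
    have hup : ∀ x, ∀ i ∈ P, Function.update G e x i = G i := fun x i hi =>
      Function.update_of_ne (by rintro rfl; exact he hi) _ _
    have hset : ∀ x, ∀ i ∈ P, {j | j ∈ insert e P ∧ Function.update G e x j ∉ A ∧
        Beats (u j) j (u i) i} = {j | j ∈ P ∧ G j ∉ A ∧ Beats (u j) j (u i) i} := by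
      intro x i hi
      ext j
      simp only [Finset.mem_insert, Set.mem_ofPred_eq]
      constructor
      · rintro ⟨rfl | hj, h1, h2⟩
        · exact absurd (hP i hi) h2.asymm
        · exact ⟨hj, hup x j hj ▸ h1, h2⟩
      · rintro ⟨hj, h1, h2⟩
        exact ⟨Or.inr hj, (hup x j hj).symm ▸ h1, h2⟩
    have hsete : ∀ x, {j | j ∈ insert e P ∧ Function.update G e x j ∉ A ∧
        Beats (u j) j (u e) e} = B := by
      intro x
      ext j
      simp only [Finset.mem_insert, Set.mem_ofPred_eq, hB]
      constructor
      · rintro ⟨rfl | hj, h1, h2⟩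
        · exact absurd h2 (beats_irrefl _ _)
        · exact ⟨hj, hup x j hj ▸ h1⟩
      · rintro ⟨hj, h1⟩
        exact ⟨Or.inr hj, (hup x j hj).symm ▸ h1, hP j hj⟩
    have hfil : ∀ x, ((insert e P).filter fun i => Function.update G e x i ∈ A ∧
        i ∉ M.closure {j | j ∈ insert e P ∧ Function.update G e x j ∉ A ∧
          Beats (u j) j (u i) i}) =
        if x ∈ A ∧ e ∉ M.closure B then insert e Z else Z := by
      intro x
      rw [Finset.filter_insert, hsete x]
      have : (P.filter fun i => Function.update G e x i ∈ A ∧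
          i ∉ M.closure {j | j ∈ insert e P ∧ Function.update G e x j ∉ A ∧
            Beats (u j) j (u i) i}) = Z :=
        Finset.filter_congr fun i hi => by rw [hset x i hi, hup x i hi]
      rw [this]
      simp only [Function.update_self]
    have heZ : e ∉ Z := fun h => he (Finset.mem_filter.1 h).1
    have hBx : ∀ x, {j | j ∈ insert e P ∧ Function.update G e x j ∉ A} =
        if x ∈ A then B else insert e B := by
      intro x
      ext j
      by_cases hx : x ∈ A <;> simp only [hx, if_true, if_false, Finset.mem_insert,
        Set.mem_ofPred_eq, Set.mem_insert_iff, hB]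
      · constructor
        · rintro ⟨rfl | hj, h1⟩
          · simp [hx] at h1
          · exact ⟨hj, hup x j hj ▸ h1⟩
        · rintro ⟨hj, h1⟩
          exact ⟨Or.inr hj, (hup x j hj).symm ▸ h1⟩
      · constructor
        · rintro ⟨rfl | hj, h1⟩
          · exact Or.inl rfl
          · exact Or.inr ⟨hj, hup x j hj ▸ h1⟩
        · rintro (rfl | ⟨hj, h1⟩)
          · simp [hx]
          · exact ⟨Or.inr hj, (hup x j hj).symm ▸ h1⟩
    simp_rw [hfil, hBx]
    by_cases hcl : e ∈ M.closure B
    · have : ∀ x, M.natRk (if x ∈ A then B else insert e B) = M.natRk B := by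
        intro x
        split_ifs
        · rfl
        · exact Matroid.natRk_insert_of_mem hcl
      simp [hcl, this]
    -- When `e` is not spanned by `B`, a marked `e` contributes one factor `a` and an unmarked `e`
    -- raises the rank, contributing one factor `b`; `hab` bounds the average factor by 1.
    · simp only [hcl, not_false_eq_true, and_true]
      have hval : ∀ x, a ^ (if x ∈ A then insert e Z else Z).card *
          b ^ M.natRk (if x ∈ A then B else insert e B) =
          (A.indicator (fun _ => a) x + Aᶜ.indicator (fun _ => b) x) *
            (a ^ Z.card * b ^ M.natRk B) := by
        intro x
        by_cases hx : x ∈ A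
        · simp only [hx, if_true, Set.indicator_of_mem, Set.mem_compl_iff, not_true_eq_false,
            not_false_eq_true, Set.indicator_of_notMem, add_zero,
            Finset.card_insert_of_notMem heZ]
          ring
        · simp only [hx, if_false, Set.indicator_of_mem, Set.mem_compl_iff,
            not_false_eq_true, Set.indicator_of_notMem, zero_add,
            Matroid.natRk_insert_of_notMem (show e ∈ M.E by simp [hE]) hcl]
          ring
      simp_rw [hval]
      rw [lintegral_mul_const _ Measurable.of_discrete,
        lintegral_add_left Measurable.of_discrete,
        lintegral_indicator_const .of_discrete, lintegral_indicator_const .of_discrete]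
      calc _ ≤ 1 * (a ^ Z.card * b ^ M.natRk B) := by
            gcongr
            rwa [mul_comm a, mul_comm b]
        _ = _ := one_mul _

end Greedy

/-! ### Uniform measures on finite types. -/

section Uniform

/-- The uniform probability measure on a finite type. -/
noncomputable def uniformMeasure (K : Type*) [Fintype K] [MeasurableSpace K] : Measure K :=
  ProbabilityTheory.uniformOn Set.univ

instance {K : Type*} [Fintype K] [Nonempty K] [MeasurableSpace K] [MeasurableSingletonClass K] :
    IsProbabilityMeasure (uniformMeasure K) :=
  ProbabilityTheory.isProbabilityMeasure_uniformOn Set.finite_univ Set.univ_nonempty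

theorem uniformMeasure_singleton {K : Type*} [Fintype K] [MeasurableSpace K]
    [MeasurableSingletonClass K] (g : K) : uniformMeasure K {g} = (Fintype.card K : ℝ≥0∞)⁻¹ := by
  rw [uniformMeasure, ProbabilityTheory.uniformOn_univ, Measure.count_singleton, one_div]

theorem lintegral_uniformMeasure {K : Type*} [Fintype K] [MeasurableSpace K]
    [MeasurableSingletonClass K] (f : K → ℝ≥0∞) :
    ∫⁻ x, f x ∂uniformMeasure K = ∑ x, (Fintype.card K : ℝ≥0∞)⁻¹ * f x := by
  rw [lintegral_fintype]
  simp [uniformMeasure_singleton, mul_comm]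

end Uniform

/-! ### The grouped test and its exponential moments. -/

section Reduction

variable {α : Type*} [LinearOrder α]

/-- One block of the samples which decide on the activity of the items: `k` vectors of values, and
a partition of the items into `k` groups. -/
abbrev Block (k : ℕ) (α : Type*) := (Fin k → α → ℝ≥0) × (α → Fin k)

/-- An item `i` of value `v` passes the test against the vector of its group if it is not spanned
by the items from the other groups whose sampled values are preferred to `v`. -/
def Passes (M : Matroid α) {k : ℕ} (ρ : Block k α) (i : α) (v : ℝ≥0) : Prop :=
  i ∉ M.closure {j | ρ.2 j ≠ ρ.2 i ∧ Beats (ρ.1 (ρ.2 i) j) j v i}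

theorem measurableSet_beats {Ω : Type*} [MeasurableSpace Ω] {f g : Ω → ℝ≥0} (hf : Measurable f)
    (hg : Measurable g) (i j : α) : MeasurableSet {x | Beats (f x) j (g x) i} := by
  have : {x | Beats (f x) j (g x) i} = {x | g x < f x} ∪ ({x | f x = g x} ∩ {_x | j < i}) := by
    ext x
    simp [Beats]
  rw [this]
  exact (measurableSet_lt hg hf).union ((measurableSet_eq_fun hf hg).inter (.const _))

theorem measurableSet_notMem_closure [Fintype α] (M : Matroid α) {Ω : Type*} [MeasurableSpace Ω]
    {q : Ω → α → Prop} (hq : ∀ j, MeasurableSet {x | q x j}) (i : α) :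
    MeasurableSet {x | i ∉ M.closure {j | q x j}} := by
  classical
  let _ : MeasurableSpace (Finset α) := ⊤
  have hm : Measurable fun x => Finset.univ.filter (q x) :=
    measurable_finset_of_mem fun a => by simpa using hq a
  have := hm (MeasurableSet.of_discrete (s := {S : Finset α | i ∉ M.closure (S : Set α)}))
  simpa [Set.preimage] using this

variable [Fintype α] (M : Matroid α) {k : ℕ}

theorem measurableSet_passes (i : α) :
    MeasurableSet {p : Block k α × ℝ≥0 | Passes M p.1 i p.2} := by
  refine measurableSet_notMem_closure M (fun j => ?_) i
  have : {p : Block k α × ℝ≥0 | p.1.2 j ≠ p.1.2 i ∧ Beats (p.1.1 (p.1.2 i) j) j p.2 i} =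
      ⋃ g, {p | p.1.2 i = g} ∩ ({p | p.1.2 j ≠ g} ∩ {p | Beats (p.1.1 g j) j p.2 i}) := by
    ext p
    simp
  rw [this]
  refine MeasurableSet.iUnion fun g => ?_
  have h1 : ∀ j, Measurable fun p : Block k α × ℝ≥0 => p.1.2 j := fun j => by fun_prop
  refine (h1 i (measurableSet_singleton g)).inter (MeasurableSet.inter ?_ ?_)
  · exact h1 j (measurableSet_singleton g).compl
  · exact measurableSet_beats (by fun_prop) (by fun_prop) i j

/-- The distribution of a block. -/
noncomputable def blockMeasure (k : ℕ) (D : α → Measure ℝ≥0) : Measure (Block k α) :=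
  (Measure.pi fun _ : Fin k => Measure.pi D).prod (Measure.pi fun _ : α => uniformMeasure (Fin k))

instance [NeZero k] (D : α → Measure ℝ≥0) [∀ i, IsProbabilityMeasure (D i)] :
    IsProbabilityMeasure (blockMeasure k D) := by
  unfold blockMeasure; infer_instance

/-- The expected number of items of `N` which pass the test of a block. -/
noncomputable def passMass (D : α → Measure ℝ≥0) (ρ : Block k α) (N : Finset α) : ℝ :=
  ∑ i ∈ N, (D i).real {v | Passes M ρ i v}

theorem measurable_passProb (D : α → Measure ℝ≥0) [∀ i, IsProbabilityMeasure (D i)] (i : α) :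
    Measurable fun ρ : Block k α => D i {v | Passes M ρ i v} :=
  measurable_measure_prodMk_left (measurableSet_passes M i)

theorem measurable_passMass (D : α → Measure ℝ≥0) [∀ i, IsProbabilityMeasure (D i)]
    (N : Finset α) : Measurable fun ρ : Block k α => passMass M D ρ N :=
  Finset.measurable_sum _ fun i _ => (measurable_passProb M D i).ennreal_toReal

open scoped Classical in
/-- The number of items of `N` in the group `g` which pass the test with the values `v`. -/
noncomputable def passCount (ρ : Block k α) (g : Fin k) (N : Finset α) (v : α → ℝ≥0) : ℕ :=
  (N.filter fun i => ρ.2 i = g ∧ Passes M ρ i (v i)).card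

theorem measurable_passCount (g : Fin k) (N : Finset α) :
    Measurable fun p : Block k α × (α → ℝ≥0) => passCount M p.1 g N p.2 := by
  classical
  have : (fun p : Block k α × (α → ℝ≥0) => passCount M p.1 g N p.2) = fun p => ∑ i ∈ N,
      Set.indicator ({p | p.1.2 i = g} ∩ {p | Passes M p.1 i (p.2 i)}) (fun _ => 1) p := by
    funext p
    rw [passCount, Finset.card_filter]
    simp only [Set.indicator_apply, Set.mem_inter_iff, Set.mem_ofPred_eq]
  rw [this]
  refine Finset.measurable_sum _ fun i _ => measurable_const.indicator (MeasurableSet.inter ?_ ?_)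
  · have h1 : Measurable fun p : Block k α × (α → ℝ≥0) => p.1.2 i := by fun_prop
    exact h1 (measurableSet_singleton g)
  · have h1 : Measurable fun p : Block k α × (α → ℝ≥0) => (p.1, p.2 i) := by fun_prop
    exact h1 (measurableSet_passes M i)

variable {D : α → Measure ℝ≥0} [∀ i, IsProbabilityMeasure (D i)]

-- Jensen's inequality: with the block fixed, the sum of passing probabilities over a group is the
-- mean of `passCount`.
open scoped Classical in
theorem exp_passMass_group_le (ρ : Block k α) (g : Fin k) (N : Finset α) (η : ℝ) :
    ENNReal.ofReal (Real.exp (η * ∑ i ∈ N with ρ.2 i = g, (D i).real {v | Passes M ρ i v})) ≤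
      ∫⁻ v, ENNReal.ofReal (Real.exp (η * passCount M ρ g N v)) ∂Measure.pi D := by
  have hcm : Measurable fun v => (passCount M ρ g N v : ℝ) := by
    have : Measurable fun v : α → ℝ≥0 => (ρ, v) := by fun_prop
    exact measurable_from_top.comp ((measurable_passCount M g N).comp this)
  have hcb : ∀ v, |(passCount M ρ g N v : ℝ)| ≤ N.card := fun v => by
    rw [abs_of_nonneg (by positivity)]
    exact_mod_cast Finset.card_filter_le _ _
  have hpm : ∀ i, MeasurableSet {v : ℝ≥0 | Passes M ρ i v} := fun i => by
    have : Measurable fun v : ℝ≥0 => (ρ, v) := by fun_prop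
    exact this (measurableSet_passes M i)
  have hci : Integrable (fun v => η * (passCount M ρ g N v : ℝ)) (Measure.pi D) :=
    (Integrable.of_bound hcm.aestronglyMeasurable N.card (.of_forall hcb)).const_mul η
  have hei : Integrable (fun v => Real.exp (η * (passCount M ρ g N v : ℝ))) (Measure.pi D) := by
    refine Integrable.of_bound (hcm.const_mul η).exp.aestronglyMeasurable (Real.exp (|η| * N.card)) (.of_forall fun v => ?_)
    rw [Real.norm_of_nonneg (Real.exp_pos _).le, Real.exp_le_exp]
    calc _ ≤ |η * (passCount M ρ g N v : ℝ)| := le_abs_self _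
      _ ≤ _ := by rw [abs_mul]; gcongr; exact hcb v
  have hmean : ∫ v, η * (passCount M ρ g N v : ℝ) ∂Measure.pi D =
      η * ∑ i ∈ N with ρ.2 i = g, (D i).real {v | Passes M ρ i v} := by
    rw [integral_const_mul]
    congr 1
    have : ∀ v, (passCount M ρ g N v : ℝ) = ∑ i ∈ N with ρ.2 i = g,
        Set.indicator {v | Passes M ρ i v} (fun _ => (1 : ℝ)) (v i) := by
      intro v
      simp [passCount, Set.indicator_apply, Finset.filter_filter]
    simp_rw [this]
    have hind : ∀ i, (fun v : α → ℝ≥0 => Set.indicator {v | Passes M ρ i v}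
        (fun _ => (1 : ℝ)) (v i)) = Set.indicator (Function.eval i ⁻¹' {v | Passes M ρ i v})
        (fun _ => (1 : ℝ)) := fun i => rfl
    rw [integral_finsetSum _ fun i _ => ?_]
    · refine Finset.sum_congr rfl fun i _ => ?_
      rw [hind, integral_indicator_const _ (measurable_pi_apply i (hpm i)), measureReal_def,
        (measurePreserving_eval D i).measure_preimage (hpm i).nullMeasurableSet]
      simp [measureReal_def]
    · rw [hind]
      exact (integrable_const _).indicator (measurable_pi_apply i (hpm i))
  rw [← ofReal_integral_eq_lintegral_ofReal hei (.of_forall fun v => (Real.exp_pos _).le)]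
  refine ENNReal.ofReal_le_ofReal ?_
  rw [← hmean]
  exact (convexOn_exp).map_integral_le Real.continuous_exp.continuousOn isClosed_univ (by simp)
    hci hei

-- Being in group `g` plays the role of being marked. The marking estimate with `a = exp η` controls
-- the count against `b` to the rank of the unmarked items; as `b ≤ 1` and this rank is at most
-- `I.card`, the compensating factor is at most `b⁻¹ ^ I.card`.
open scoped Classical in
theorem lintegral_exp_passCount_le [NeZero k] (hE : M.E = Set.univ) {I : Finset α}
    (N : Finset α) (hN : (N : Set α) ⊆ M.closure (I : Set α))
    (g : Fin k) {η b : ℝ} (hη : 0 ≤ η) (hb0 : 0 < b) (hb1 : b ≤ 1)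
    (hab : Real.exp η / k + (1 - 1 / k) * b ≤ 1) :
    ∫⁻ ρ, ∫⁻ v, ENNReal.ofReal (Real.exp (η * passCount M ρ g N v)) ∂Measure.pi D
      ∂blockMeasure k D ≤ ENNReal.ofReal (b⁻¹ ^ I.card) := by
  let f : (α → Fin k) → (α → ℝ≥0) → ℝ≥0∞ := fun G u => ENNReal.ofReal (Real.exp (η *
    (N.filter fun i => G i = g ∧ i ∉ M.closure {j | G j ≠ g ∧ Beats (u j) j (u i) i}).card))
  have hfm : ∀ G, Measurable (f G) := by
    intro G
    refine (Measurable.exp (Measurable.const_mul (measurable_from_top.comp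
      (f := fun u : α → ℝ≥0 => (N.filter fun i => G i = g ∧ i ∉ M.closure
        {j | G j ≠ g ∧ Beats (u j) j (u i) i}).card) ?_) η)).ennreal_ofReal
    simp_rw [Finset.card_filter]
    refine Finset.measurable_sum _ fun i _ => Measurable.ite ?_ measurable_const measurable_const
    refine MeasurableSet.inter (.const _) (measurableSet_notMem_closure M (fun j => ?_) i)
    exact MeasurableSet.inter (.const _)
      (measurableSet_beats (measurable_pi_apply j) (measurable_pi_apply i) i j)
  -- Items of group `g` consult only the vector `s g`, and only at items outside the group.
  -- Overwriting `s g` by `v` on the group therefore leaves a single vector `u` distributed as the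
  -- values, to which the deterministic-order estimate applies.
  have hmix : ∀ (s : Fin k → α → ℝ≥0) (G : α → Fin k) (v : α → ℝ≥0),
      ENNReal.ofReal (Real.exp (η * passCount M (s, G) g N v)) =
        f G (fun j => if j ∈ {j | G j = g} then v j else s g j) := by
    intro s G v
    simp only [f, passCount]
    congr 5
    ext i
    simp only [Finset.mem_filter]
    refine and_congr_right fun _ => and_congr_right fun hi => ?_
    simp only [Passes, hi]
    suffices {j | G j ≠ g ∧ Beats (s g j) j (v i) i} = {j | G j ≠ g ∧
        Beats (if j ∈ {j | G j = g} then v j else s g j) j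
          (if i ∈ {j | G j = g} then v i else s g i) i} by rw [this]
    ext j
    simp only [Set.mem_ofPred_eq, hi, if_true]
    refine and_congr_right fun hj => ?_
    rw [if_neg hj]
  have hmeas : Measurable fun p : Block k α × (α → ℝ≥0) =>
      ENNReal.ofReal (Real.exp (η * passCount M p.1 g N p.2)) :=
    (Measurable.exp (Measurable.const_mul (measurable_from_top.comp
      (measurable_passCount M g N)) η)).ennreal_ofReal
  rw [blockMeasure, lintegral_prod_symm _ hmeas.lintegral_prod_right'.aemeasurable]
  have hG : ∀ G : α → Fin k, ∫⁻ s, ∫⁻ v, ENNReal.ofReal (Real.exp (η *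
      passCount M (s, G) g N v)) ∂Measure.pi D ∂Measure.pi (fun _ : Fin k => Measure.pi D) =
      ∫⁻ u, f G u ∂Measure.pi D := by
    intro G
    simp_rw [hmix]
    have h1 := measurePreserving_pi_mix D {j | G j = g}
    rw [← lintegral_pi_mix D {j | G j = g} (hfm G)]
    exact (measurePreserving_eval (fun _ : Fin k => Measure.pi D) g).lintegral_comp
      (f := fun s0 => ∫⁻ v, f G (fun j => if j ∈ {j | G j = g} then v j else s0 j) ∂Measure.pi D)
      ((hfm G).comp h1.measurable).lintegral_prod_right'
  simp_rw [hG]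
  -- From here `u`, and with it the preference order, is fixed, and only the grouping is random.
  rw [lintegral_lintegral_swap (by
    refine Measurable.aemeasurable ?_
    exact measurable_from_prod_countable_right hfm)]
  refine (lintegral_mono fun u => ?_ : _ ≤ ∫⁻ _, ENNReal.ofReal (b⁻¹ ^ I.card) ∂Measure.pi D).trans
    (by simp)
  have hcomb := lintegral_marked_pow_le hE u (uniformMeasure (Fin k)) {g}
    (ENNReal.ofReal (Real.exp η)) (ENNReal.ofReal b) ?_ N
  · have hle : ∀ G : α → Fin k, f G u ≤ ENNReal.ofReal (b⁻¹ ^ I.card) *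
        (ENNReal.ofReal (Real.exp η) ^ (N.filter fun i => G i ∈ ({g} : Set (Fin k)) ∧
          i ∉ M.closure {j | j ∈ N ∧ G j ∉ ({g} : Set (Fin k)) ∧ Beats (u j) j (u i) i}).card *
        ENNReal.ofReal b ^ M.natRk {j | j ∈ N ∧ G j ∉ ({g} : Set (Fin k))}) := by
      intro G
      simp only [f]
      rw [← ENNReal.ofReal_pow (Real.exp_pos _).le, ← ENNReal.ofReal_pow hb0.le,
        ← ENNReal.ofReal_mul (by positivity), ← ENNReal.ofReal_mul (by positivity)]
      refine ENNReal.ofReal_le_ofReal ?_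
      have h1 : M.natRk {j | j ∈ N ∧ G j ∉ ({g} : Set (Fin k))} ≤ I.card :=
        (M.natRk_mono (fun j hj => hN hj.1)).trans (by
          rw [M.natRk_closure]
          simpa using M.natRk_le_ncard (I : Set α))
      have h2 : (1 : ℝ) ≤ b⁻¹ ^ I.card * b ^ M.natRk {j | j ∈ N ∧ G j ∉ ({g} : Set (Fin k))} := by
        calc (1 : ℝ) = b⁻¹ ^ I.card * b ^ I.card := by
              rw [← mul_pow, inv_mul_cancel₀ hb0.ne', one_pow]
          _ ≤ _ := by gcongr ?_ * ?_; exact pow_le_pow_of_le_one hb0.le hb1 h1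
      -- Keeping only the competitors inside `N` can only let more items pass.
      have h3 : Real.exp (η * ((N.filter fun i => G i = g ∧ i ∉ M.closure
          {j | G j ≠ g ∧ Beats (u j) j (u i) i}).card : ℝ)) ≤ Real.exp η ^ (N.filter fun i =>
          G i ∈ ({g} : Set (Fin k)) ∧ i ∉ M.closure {j | j ∈ N ∧ G j ∉ ({g} : Set (Fin k)) ∧
            Beats (u j) j (u i) i}).card := by
        rw [← Real.exp_nat_mul, mul_comm, Real.exp_le_exp]
        refine mul_le_mul_of_nonneg_right ?_ hη
        refine Nat.cast_le.2 (Finset.card_le_card fun i hi => ?_)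
        rw [Finset.mem_filter] at hi ⊢
        exact ⟨hi.1, hi.2.1, fun hcl => hi.2.2 (M.closure_subset_closure (fun j hj => hj.2) hcl)⟩
      calc _ ≤ _ := h3
        _ ≤ _ * (b⁻¹ ^ I.card * b ^ M.natRk {j | j ∈ N ∧ G j ∉ ({g} : Set (Fin k))}) :=
          le_mul_of_one_le_right (by positivity) h2
        _ = _ := by ring
    refine (lintegral_mono hle).trans ?_
    rw [lintegral_const_mul _ Measurable.of_discrete]
    calc _ ≤ ENNReal.ofReal (b⁻¹ ^ I.card) * 1 := by
          gcongr
          refine le_trans (le_of_eq ?_) hcomb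
          congr!
      _ = _ := mul_one _
  · rw [prob_compl_eq_one_sub (measurableSet_singleton g), uniformMeasure_singleton,
      Fintype.card_fin]
    have hk : (0 : ℝ) < k := by exact_mod_cast Nat.pos_of_ne_zero (NeZero.ne k)
    have hk1 : (1 : ℝ) ≤ k := by exact_mod_cast Nat.pos_of_ne_zero (NeZero.ne k)
    have e1 : ((k : ℝ≥0∞))⁻¹ = ENNReal.ofReal (1 / k) := by
      rw [one_div, ENNReal.ofReal_inv_of_pos hk, ENNReal.ofReal_natCast]
    have h0 : (0 : ℝ) ≤ 1 - 1 / k := by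
      rw [sub_nonneg, div_le_one hk]; exact hk1
    rw [e1, ← ENNReal.ofReal_one, ← ENNReal.ofReal_sub _ (by positivity),
      ← ENNReal.ofReal_mul (by positivity), ← ENNReal.ofReal_mul h0,
      ← ENNReal.ofReal_add (by positivity) (by positivity)]
    refine ENNReal.ofReal_le_ofReal ?_
    rwa [one_div_mul_eq_div]

/-- The group counts of one block are dependent. Convexity of `exp` with weights `1 / k` reduces the
block to single groups, at the price of replacing `lam` by `k * lam`. -/
theorem lintegral_exp_passMass_le [NeZero k] (hE : M.E = Set.univ) {I : Finset α}
    (N : Finset α) (hN : (N : Set α) ⊆ M.closure (I : Set α))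
    {lam b : ℝ} (hlam : 0 ≤ lam) (hb0 : 0 < b) (hb1 : b ≤ 1)
    (hab : Real.exp (k * lam) / k + (1 - 1 / k) * b ≤ 1) :
    ∫⁻ ρ, ENNReal.ofReal (Real.exp (lam * passMass M D ρ N)) ∂blockMeasure k D ≤
      ENNReal.ofReal (b⁻¹ ^ I.card) := by
  classical
  have hk : (0 : ℝ) < k := by exact_mod_cast Nat.pos_of_ne_zero (NeZero.ne k)
  have hpt : ∀ ρ : Block k α, ENNReal.ofReal (Real.exp (lam * passMass M D ρ N)) ≤
      ∑ g : Fin k, ENNReal.ofReal (1 / k) *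
        ∫⁻ v, ENNReal.ofReal (Real.exp (k * lam * passCount M ρ g N v)) ∂Measure.pi D := by
    intro ρ
    have h1 : lam * passMass M D ρ N = ∑ g : Fin k, (1 / k : ℝ) • (k * lam *
        ∑ i ∈ N with ρ.2 i = g, (D i).real {v | Passes M ρ i v}) := by
      rw [passMass, ← Finset.sum_fiberwise N ρ.2, Finset.mul_sum]
      refine Finset.sum_congr rfl fun g _ => ?_
      rw [smul_eq_mul]
      field_simp
    have h2 := convexOn_exp.map_sum_le (t := Finset.univ) (w := fun _ : Fin k => (1 / k : ℝ))
      (p := fun g => k * lam * ∑ i ∈ N with ρ.2 i = g, (D i).real {v | Passes M ρ i v})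
      (fun _ _ => by positivity) (by simp [hk.ne']) (fun _ _ => Set.mem_univ _)
    rw [← h1] at h2
    refine (ENNReal.ofReal_le_ofReal h2).trans ?_
    rw [ENNReal.ofReal_sum_of_nonneg fun g _ => by positivity]
    refine Finset.sum_le_sum fun g _ => ?_
    rw [smul_eq_mul, ENNReal.ofReal_mul (by positivity)]
    gcongr
    exact exp_passMass_group_le M ρ g N (k * lam)
  refine (lintegral_mono hpt).trans ?_
  have hmeas : ∀ g, Measurable fun p : Block k α × (α → ℝ≥0) =>
      ENNReal.ofReal (Real.exp (k * lam * passCount M p.1 g N p.2)) := fun g =>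
    (Measurable.exp (Measurable.const_mul (measurable_from_top.comp
      (measurable_passCount M g N)) (k * lam))).ennreal_ofReal
  rw [lintegral_finsetSum _ fun g _ => ((hmeas g).lintegral_prod_right').const_mul _]
  calc _ ≤ ∑ _g : Fin k, ENNReal.ofReal (1 / k) * ENNReal.ofReal (b⁻¹ ^ I.card) := by
        refine Finset.sum_le_sum fun g _ => ?_
        rw [lintegral_const_mul _ (hmeas g).lintegral_prod_right']
        gcongr
        exact lintegral_exp_passCount_le M hE N hN g (by positivity) hb0 hb1 hab
    _ = _ := by
        rw [Finset.sum_const, Finset.card_univ, Fintype.card_fin, nsmul_eq_mul, ← mul_assoc,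
          ← ENNReal.ofReal_natCast, ← ENNReal.ofReal_mul (by positivity), mul_one_div_cancel hk.ne',
          ENNReal.ofReal_one, one_mul]

end Reduction

/-! ### Concentration over the blocks, uniformly over all sets of items. -/

section WellSpread

variable {α : Type*} [LinearOrder α] (M : Matroid α) {k m : ℕ}

/-- No set contains many more items passing the tests (on average over the blocks) than its rank
allows for. -/
def WellSpread (D : α → Measure ℝ≥0) (δ : ℝ) (ρ : Fin m → Block k α) : Prop :=
  ∀ N : Finset α, ∑ a, passMass M D (ρ a) N ≤ (1 + δ) * m * M.natRk (N : Set α)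

theorem passes_notMem_closure_empty {ρ : Block k α} {i : α} {v : ℝ≥0} (h : Passes M ρ i v) :
    i ∉ M.closure ∅ :=
  fun hi => h (M.closure_subset_closure (Set.empty_subset _) hi)

theorem passMass_mono (D : α → Measure ℝ≥0) (ρ : Block k α) {N N' : Finset α}
    (h : N ⊆ N') : passMass M D ρ N ≤ passMass M D ρ N' :=
  Finset.sum_le_sum_of_subset_of_nonneg h fun _ _ _ => measureReal_nonneg

variable [Fintype α] {D : α → Measure ℝ≥0} [∀ i, IsProbabilityMeasure (D i)]

theorem measurableSet_wellSpread (δ : ℝ) :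
    MeasurableSet {ρ : Fin m → Block k α | WellSpread M D δ ρ} := by
  have : {ρ : Fin m → Block k α | WellSpread M D δ ρ} =
      ⋂ N : Finset α, {ρ | ∑ a, passMass M D (ρ a) N ≤ (1 + δ) * m * M.natRk (N : Set α)} := by
    ext ρ
    simp [WellSpread]
  rw [this]
  refine MeasurableSet.iInter fun N => measurableSet_le ?_ measurable_const
  exact Finset.measurable_sum _ fun a _ => (measurable_passMass M D N).comp (measurable_pi_apply a)

/-- Chernoff's bound: the blocks are independent, so the exponential moments multiply. The result is
one factor `(exp (-(lam * (1 + δ))) * b⁻¹) ^ m` per unit of rank, which is what makes the union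
bound affordable. -/
theorem measure_passMass_gt_le [NeZero k] (hE : M.E = Set.univ) (N I : Finset α)
    (hN : (N : Set α) ⊆ M.closure (I : Set α)) {lam b δ : ℝ} (hlam : 0 ≤ lam) (hb0 : 0 < b)
    (hb1 : b ≤ 1) (hab : Real.exp (k * lam) / k + (1 - 1 / k) * b ≤ 1) :
    Measure.pi (fun _ : Fin m => blockMeasure k D)
      {ρ | (1 + δ) * m * I.card < ∑ a, passMass M D (ρ a) N} ≤
      ENNReal.ofReal (((Real.exp (-(lam * (1 + δ))) * b⁻¹) ^ m) ^ I.card) := by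
  have hm : Measurable fun ρ : Block k α =>
      ENNReal.ofReal (Real.exp (lam * passMass M D ρ N)) :=
    (((measurable_passMass M D N).const_mul lam).exp).ennreal_ofReal
  have hprod : ∫⁻ ρ, ∏ a, ENNReal.ofReal (Real.exp (lam * passMass M D (ρ a) N))
      ∂Measure.pi (fun _ : Fin m => blockMeasure k D) ≤ ENNReal.ofReal ((b⁻¹ ^ I.card) ^ m) := by
    rw [lintegral_pi_prod (fun _ : Fin m => blockMeasure k D)
      (f := fun _ ρ => ENNReal.ofReal (Real.exp (lam * passMass M D ρ N))) fun _ => hm,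
      ENNReal.ofReal_pow (by positivity), Finset.prod_const, Finset.card_univ, Fintype.card_fin]
    gcongr
    exact lintegral_exp_passMass_le M hE N hN hlam hb0 hb1 hab
  set t : ℝ := Real.exp (lam * ((1 + δ) * m * I.card)) with ht
  have htpos : 0 < t := Real.exp_pos _
  have hsub : {ρ : Fin m → Block k α | (1 + δ) * m * I.card < ∑ a, passMass M D (ρ a) N} ⊆
      {ρ | ENNReal.ofReal t ≤ ∏ a, ENNReal.ofReal (Real.exp (lam * passMass M D (ρ a) N))} := by
    intro ρ hρ
    rw [Set.mem_ofPred_eq, ← ENNReal.ofReal_prod_of_nonneg fun a _ => (Real.exp_pos _).le,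
      ← Real.exp_sum, ← Finset.mul_sum]
    refine ENNReal.ofReal_le_ofReal (Real.exp_le_exp.2 ?_)
    exact mul_le_mul_of_nonneg_left (le_of_lt hρ) hlam
  refine (measure_mono hsub).trans ?_
  have hmark := mul_meas_ge_le_lintegral (μ := Measure.pi (fun _ : Fin m => blockMeasure k D))
    (f := fun ρ => ∏ a, ENNReal.ofReal (Real.exp (lam * passMass M D (ρ a) N)))
    (Finset.measurable_prod _ fun a _ => hm.comp (measurable_pi_apply a)) (ENNReal.ofReal t)
  have h2 := hmark.trans hprod
  rw [mul_comm, ← ENNReal.le_div_iff_mul_le (Or.inl (by simpa using htpos)) (Or.inl (by simp)),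
    ← ENNReal.ofReal_div_of_pos htpos] at h2
  refine h2.trans (le_of_eq ?_)
  congr 1
  have h3 : Real.exp (-(lam * (1 + δ))) ^ (m * I.card) = t⁻¹ := by
    rw [ht, ← Real.exp_neg, ← Real.exp_nat_mul]
    congr 1
    push_cast
    ring
  rw [← pow_mul, ← pow_mul, mul_pow, h3, mul_comm I.card, div_eq_mul_inv, mul_comm]

/-- The samples are well spread with high probability. -/
theorem measure_not_wellSpread_le [NeZero k] (hE : M.E = Set.univ) {lam b δ : ℝ} (hlam : 0 ≤ lam)
    (hb0 : 0 < b) (hb1 : b ≤ 1) (hab : Real.exp (k * lam) / k + (1 - 1 / k) * b ≤ 1) :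
    Measure.pi (fun _ : Fin m => blockMeasure k D) {ρ | ¬ WellSpread M D δ ρ} ≤
      ENNReal.ofReal ((1 + (Real.exp (-(lam * (1 + δ))) * b⁻¹) ^ m) ^ Fintype.card α - 1) := by
  classical
  set q : ℝ := (Real.exp (-(lam * (1 + δ))) * b⁻¹) ^ m with hq
  have hq0 : 0 ≤ q := by positivity
  let cl : Finset α → Finset α := fun I => Finset.univ.filter (· ∈ M.closure (I : Set α))
  have hcl : ∀ I, ((cl I : Finset α) : Set α) = M.closure (I : Set α) := fun I => by
    ext; simp [cl]
  have hsub : {ρ : Fin m → Block k α | ¬ WellSpread M D δ ρ} ⊆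
      ⋃ I ∈ (Finset.univ.erase ∅ : Finset (Finset α)),
        {ρ | (1 + δ) * m * I.card < ∑ a, passMass M D (ρ a) (cl I)} := by
    intro ρ hρ
    simp only [Set.mem_ofPred_eq, WellSpread, not_forall, not_le] at hρ
    obtain ⟨N, hN⟩ := hρ
    -- Replacing `N` by the closure of a basis keeps the rank and only increases the mass, so the
    -- union may run over the sets `I`, weighted by cardinality.
    obtain ⟨I, hI, hNI, hc⟩ := Matroid.exists_indep_subset_closure hE (N : Set α)
    have hle : ∑ a, passMass M D (ρ a) N ≤ ∑ a, passMass M D (ρ a) (cl I) := by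
      refine Finset.sum_le_sum fun a _ => passMass_mono M D _ fun x hx => ?_
      have : x ∈ M.closure (I : Set α) := hNI hx
      simpa [cl] using this
    rw [← hc] at hN
    have hlt := hN.trans_le hle
    -- Loops never pass, so a set of rank 0 cannot violate the bound. Leaving out `I = ∅` accounts
    -- for the final `- 1`.
    have hne : I ≠ ∅ := by
      rintro rfl
      have h0 : ∀ a, passMass M D (ρ a) (cl ∅) = 0 := by
        intro a
        refine Finset.sum_eq_zero fun i hi => ?_
        have hi' : i ∈ M.closure ∅ := by simpa [cl] using hi
        have : {v | Passes M (ρ a) i v} = ∅ := by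
          ext v
          simp only [Set.mem_ofPred_eq, Set.mem_empty_iff_false, iff_false]
          exact fun h => passes_notMem_closure_empty M h hi'
        simp [this]
      simp [h0] at hlt
    simp only [Set.mem_iUnion, Set.mem_ofPred_eq, Finset.mem_erase, Finset.mem_univ, and_true]
    exact ⟨I, hne, hlt⟩
  refine (measure_mono hsub).trans ((measure_biUnion_finset_le _ _).trans ?_)
  calc _ ≤ ∑ I ∈ (Finset.univ.erase ∅ : Finset (Finset α)), ENNReal.ofReal (q ^ I.card) :=
        Finset.sum_le_sum fun I _ =>
          measure_passMass_gt_le M hE (cl I) I (hcl I).le hlam hb0 hb1 hab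
    _ = ENNReal.ofReal (∑ I ∈ (Finset.univ.erase ∅ : Finset (Finset α)), q ^ I.card) :=
        (ENNReal.ofReal_sum_of_nonneg fun I _ => by positivity).symm
    _ = _ := by
        congr 1
        have h1 := Finset.sum_pow_mul_eq_add_pow q 1 (Finset.univ : Finset α)
        simp only [one_pow, mul_one, Finset.powerset_univ, Finset.card_univ] at h1
        have h2 := Finset.add_sum_erase (Finset.univ : Finset (Finset α))
          (fun I => q ^ I.card) (Finset.mem_univ ∅)
        simp only [Finset.card_empty, pow_zero] at h2
        rw [add_comm q 1] at h1
        linarith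

end WellSpread

/-! ### Active items: value captured and marginals. -/

section Activity

variable {α : Type*} [LinearOrder α] [Fintype α] (M : Matroid α) {k m : ℕ}

theorem measurableSet_mem_greedy (i : α) : MeasurableSet {u : α → ℝ≥0 | i ∈ greedy M u} :=
  measurableSet_notMem_closure M (fun j =>
    measurableSet_beats (measurable_pi_apply j) (measurable_pi_apply i) i j) i

variable {D : α → Measure ℝ≥0} [∀ i, IsProbabilityMeasure (D i)]

/-- An item passes the test of a random block at least as often as it is in the greedy basis. -/
theorem lintegral_greedy_le_passes [NeZero k] (i : α) {w : ℝ≥0 → ℝ≥0∞} (hw : Measurable w) :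
    ∫⁻ u, Set.indicator {u | i ∈ greedy M u} (fun u => w (u i)) u ∂Measure.pi D ≤
      ∫⁻ ρ : Block k α, ∫⁻ v, Set.indicator {v | Passes M ρ i v} w v ∂D i ∂blockMeasure k D := by
  set h : (α → ℝ≥0) → ℝ≥0∞ := Set.indicator {u | i ∈ greedy M u} (fun u => w (u i)) with hh
  have hmh : Measurable h :=
    (hw.comp (measurable_pi_apply i)).indicator (measurableSet_mem_greedy M i)
  have hmeas : Measurable fun p : Block k α × ℝ≥0 =>
      Set.indicator {v | Passes M p.1 i v} w p.2 :=
    (hw.comp measurable_snd).indicator (measurableSet_passes M i)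
  rw [blockMeasure, lintegral_prod_symm _ hmeas.lintegral_prod_right'.aemeasurable]
  have hG : ∀ G : α → Fin k, ∫⁻ u, h u ∂Measure.pi D ≤ ∫⁻ s, ∫⁻ v,
      Set.indicator {v | Passes M ((s, G) : Block k α) i v} w v ∂D i
        ∂Measure.pi (fun _ : Fin k => Measure.pi D) := by
    intro G
    classical
    -- The item `i` is in its own group, so the test never looks at `s (G i) i`; putting `v` there
    -- and ignoring the rest of the group only removes competitors.
    have hle : ∀ (s : Fin k → α → ℝ≥0) v, h (Function.update (s (G i)) i v) ≤
        Set.indicator {v | Passes M ((s, G) : Block k α) i v} w v := by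
      intro s v
      simp only [hh, Set.indicator_apply, Set.mem_ofPred_eq, Function.update_self]
      by_cases hg : i ∈ greedy M (Function.update (s (G i)) i v)
      · rw [if_pos hg, if_pos (show Passes M _ i v from ?_)]
        intro hcl
        refine hg (M.closure_subset_closure ?_ hcl)
        rintro j ⟨hj, hb⟩
        have hji : j ≠ i := by rintro rfl; exact hj rfl
        simpa [Function.update_of_ne hji] using hb
      · rw [if_neg hg]
        exact zero_le
    have hup : Measurable fun s0 : α → ℝ≥0 => ∫⁻ v, h (Function.update s0 i v) ∂D i := by
      refine Measurable.lintegral_prod_right'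
        (f := fun p : (α → ℝ≥0) × ℝ≥0 => h (Function.update p.1 i p.2)) (hmh.comp ?_)
      exact measurable_update'
    rw [lintegral_pi_update D i hmh, ← (measurePreserving_eval
      (fun _ : Fin k => Measure.pi D) (G i)).lintegral_comp hup]
    exact lintegral_mono fun s => lintegral_mono fun v => hle s v
  calc _ = ∫⁻ _G : α → Fin k, ∫⁻ u, h u ∂Measure.pi D
          ∂Measure.pi (fun _ : α => uniformMeasure (Fin k)) := by simp
    _ ≤ _ := lintegral_mono hG

/-- The internal randomness deciding on the activity of an item: the block whose test is used, and
a fair coin. -/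
abbrev Coin (m : ℕ) := Fin m × Bool

/-- An item is active if its coin shows heads and it passes the test of its block. -/
def Active (ρ : Fin m → Block k α) (i : α) (x : ℝ≥0 × Coin m) : Prop :=
  x.2.2 = true ∧ Passes M (ρ x.2.1) i x.1

/-- The joint distribution of the value and the coin of an item. -/
noncomputable def itemMeasure (m : ℕ) (D : α → Measure ℝ≥0) (i : α) : Measure (ℝ≥0 × Coin m) :=
  (D i).prod (uniformMeasure (Coin m))

instance [NeZero m] (i : α) : IsProbabilityMeasure (itemMeasure m D i) := by
  unfold itemMeasure; infer_instance

theorem measurableSet_active_prod (i : α) :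
    MeasurableSet {p : (Fin m → Block k α) × (ℝ≥0 × Coin m) | Active M p.1 i p.2} := by
  have : {p : (Fin m → Block k α) × (ℝ≥0 × Coin m) | Active M p.1 i p.2} =
      ⋃ a, {p | p.2.2 = (a, true)} ∩ {p | Passes M (p.1 a) i p.2.1} := by
    ext p
    simp only [Active, Set.mem_ofPred_eq, Set.mem_iUnion, Set.mem_inter_iff]
    constructor
    · rintro ⟨h1, h2⟩
      exact ⟨p.2.2.1, Prod.ext rfl h1, h2⟩
    · rintro ⟨a, h1, h2⟩
      rw [h1]
      exact ⟨rfl, h2⟩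
  rw [this]
  refine MeasurableSet.iUnion fun a => MeasurableSet.inter ?_ ?_
  · have h1 : Measurable fun p : (Fin m → Block k α) × (ℝ≥0 × Coin m) => p.2.2 := by fun_prop
    exact h1 (measurableSet_singleton _)
  · have h1 : Measurable fun p : (Fin m → Block k α) × (ℝ≥0 × Coin m) => (p.1 a, p.2.1) := by
      fun_prop
    exact h1 (measurableSet_passes M i)

theorem measurableSet_active (ρ : Fin m → Block k α) (i : α) :
    MeasurableSet {x | Active M ρ i x} := by
  have h1 : Measurable fun x : ℝ≥0 × Coin m => (ρ, x) := by fun_prop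
  exact h1 (measurableSet_active_prod M i)

theorem lintegral_active [NeZero m] (ρ : Fin m → Block k α) (i : α) {w : ℝ≥0 → ℝ≥0∞}
    (hw : Measurable w) :
    ∫⁻ x, Set.indicator {x | Active M ρ i x} (fun x => w x.1) x ∂itemMeasure m D i =
      (2 * m : ℝ≥0∞)⁻¹ * ∑ a, ∫⁻ v, Set.indicator {v | Passes M (ρ a) i v} w v ∂D i := by
  have hmeas : Measurable (Set.indicator {x | Active M ρ i x} (fun x => w x.1)) :=
    (hw.comp measurable_fst).indicator (measurableSet_active M ρ i)
  classical
  rw [itemMeasure, lintegral_prod_symm _ hmeas.aemeasurable, lintegral_uniformMeasure,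
    Fintype.sum_prod_type, Finset.mul_sum]
  refine Finset.sum_congr rfl fun a _ => ?_
  have h1 : ∀ v, Set.indicator {x : ℝ≥0 × Coin m | Active M ρ i x} (fun x => w x.1)
      (v, (a, true)) = Set.indicator {v | Passes M (ρ a) i v} w v := by
    intro v
    simp [Active, Set.indicator_apply]
  have h2 : ∀ v, Set.indicator {x : ℝ≥0 × Coin m | Active M ρ i x} (fun x => w x.1)
      (v, (a, false)) = 0 := by
    intro v
    simp [Active]
  simp [h1, h2, mul_comm]

/-- This is the only consequence of `WellSpread` that contention resolution uses: the activity
probabilities lie in the matroid polytope scaled by `(1 + δ) / 2`. The random block averages the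
tests and the coin halves them. -/
theorem sum_measure_active_le [NeZero m] {δ : ℝ} (ρ : Fin m → Block k α) (h : WellSpread M D δ ρ)
    (N : Finset α) :
    ∑ i ∈ N, (itemMeasure m D i).real {x | Active M ρ i x} ≤
      (1 + δ) / 2 * M.natRk (N : Set α) := by
  have hm : (0 : ℝ) < m := by exact_mod_cast Nat.pos_of_ne_zero (NeZero.ne m)
  have hpm : ∀ a i, MeasurableSet {v : ℝ≥0 | Passes M (ρ a) i v} := fun a i => by
    have : Measurable fun v : ℝ≥0 => (ρ a, v) := by fun_prop
    exact this (measurableSet_passes M i)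
  have h1 : ∀ i, (itemMeasure m D i).real {x | Active M ρ i x} =
      (2 * m : ℝ)⁻¹ * ∑ a, (D i).real {v | Passes M (ρ a) i v} := by
    intro i
    have := lintegral_active M (D := D) ρ i (w := fun _ => 1) measurable_const
    rw [lintegral_indicator_const (measurableSet_active M ρ i), one_mul] at this
    simp_rw [lintegral_indicator_const (hpm _ _), one_mul] at this
    rw [measureReal_def, this, ENNReal.toReal_mul, ENNReal.toReal_sum fun a _ => measure_ne_top _ _]
    simp [measureReal_def]
  simp_rw [h1]
  rw [← Finset.mul_sum, Finset.sum_comm]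
  have h2 := h N
  unfold passMass at h2
  calc _ ≤ (2 * m : ℝ)⁻¹ * ((1 + δ) * m * M.natRk (N : Set α)) := by gcongr
    _ = _ := by field_simp

/-- On average over the samples, an item is active at least half as often as it is in the greedy
basis. -/
theorem lintegral_greedy_le_active [NeZero k] [NeZero m] (i : α) {w : ℝ≥0 → ℝ≥0∞}
    (hw : Measurable w) :
    2⁻¹ * ∫⁻ u, Set.indicator {u | i ∈ greedy M u} (fun u => w (u i)) u ∂Measure.pi D ≤
      ∫⁻ ρ, ∫⁻ x, Set.indicator {x | Active M ρ i x} (fun x => w x.1) x ∂itemMeasure m D i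
        ∂Measure.pi (fun _ : Fin m => blockMeasure k D) := by
  have hmeas : Measurable fun ρ : Block k α =>
      ∫⁻ v, Set.indicator {v | Passes M ρ i v} w v ∂D i := by
    refine Measurable.lintegral_prod_right' (f := fun p : Block k α × ℝ≥0 =>
      Set.indicator {v | Passes M p.1 i v} w p.2) ?_
    exact (hw.comp measurable_snd).indicator (measurableSet_passes M i)
  have hmeas' : ∀ a, Measurable fun ρ : Fin m → Block k α =>
      ∫⁻ v, Set.indicator {v | Passes M (ρ a) i v} w v ∂D i := fun a =>
    hmeas.comp (measurable_pi_apply a)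
  simp_rw [lintegral_active M _ i hw]
  rw [lintegral_const_mul _ (Finset.measurable_sum _ fun a _ => hmeas' a),
    lintegral_finsetSum _ fun a _ => hmeas' a]
  have h1 : ∀ a, ∫⁻ ρ : Fin m → Block k α, ∫⁻ v, Set.indicator {v | Passes M (ρ a) i v} w v ∂D i
      ∂Measure.pi (fun _ : Fin m => blockMeasure k D) = ∫⁻ ρ : Block k α, ∫⁻ v,
        Set.indicator {v | Passes M ρ i v} w v ∂D i ∂blockMeasure k D := fun a =>
    (measurePreserving_eval (fun _ : Fin m => blockMeasure k D) a).lintegral_comp hmeas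
  simp_rw [h1]
  rw [Finset.sum_const, Finset.card_univ, Fintype.card_fin, nsmul_eq_mul, ← mul_assoc,
    ENNReal.mul_inv (by simp) (by simp), mul_assoc 2⁻¹, ENNReal.inv_mul_cancel
      (by simpa using NeZero.ne m) (by simp), mul_one]
  gcongr
  exact lintegral_greedy_le_passes M i hw

theorem lintegral_active_le [NeZero m] (ρ : Fin m → Block k α) (i : α) {w : ℝ≥0 → ℝ≥0∞}
    (hw : Measurable w) :
    ∫⁻ x, Set.indicator {x | Active M ρ i x} (fun x => w x.1) x ∂itemMeasure m D i ≤
      2⁻¹ * ∫⁻ v, w v ∂D i := by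
  rw [lintegral_active M ρ i hw]
  calc _ ≤ (2 * m : ℝ≥0∞)⁻¹ * ∑ _a : Fin m, ∫⁻ v, w v ∂D i := by
        gcongr
        exact Set.indicator_le_self _ _ _
    _ = _ := by
      rw [Finset.sum_const, Finset.card_univ, Fintype.card_fin, nsmul_eq_mul, ← mul_assoc,
        ENNReal.mul_inv (by simp) (by simp), mul_assoc 2⁻¹, ENNReal.inv_mul_cancel
        (by simpa using NeZero.ne m) (by simp), mul_one]

end Activity

instance instMeasurableSpaceFinset (α : Type*) : MeasurableSpace (Finset α) := ⊤

instance (α : Type*) : DiscreteMeasurableSpace (Finset α) := ⟨fun _ => trivial⟩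

/-! ### The chain of ground sets: rank decay, estimation from samples, random stopping. -/

section Chain

variable {α : Type*} [Fintype α] [DecidableEq α] (M : Matroid α) {T : ℕ}

/-- The probability that an item is spanned by a set `S` and the other items of `N` which belong to
a random set. -/
noncomputable def spanProb (ν : Measure (Finset α)) (N S : Finset α) (i : α) : ℝ :=
  ν.real {R | i ∈ M.closure (((R ∩ N).erase i ∪ S : Finset α) : Set α)}

open scoped Classical in
/-- The number of sets of a given list which, restricted to `N` and without `i`, together with `S`
span the item `i`. -/
noncomputable def spanCount (R : Fin T → Finset α) (N S : Finset α) (i : α) : ℕ :=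
  (Finset.univ.filter fun t => i ∈ M.closure (((R t ∩ N).erase i ∪ S : Finset α) : Set α)).card

open scoped Classical in
/-- Enlarge `S` by the items of `N` which are often spanned. -/
noncomputable def enlarge (θ : ℝ) (N : Finset α) (R : Fin T → Finset α) (S : Finset α) :
    Finset α :=
  S ∪ N.filter fun i => θ * T < spanCount M R N S i

/-- The sets obtained from `∅` by successive enlargements inside `N`. -/
noncomputable def layerChain (θ : ℝ) (N : Finset α) (R : ℕ → Fin T → Finset α) : ℕ → Finset α
  | 0 => ∅
  | j + 1 => enlarge M θ N (R j) (layerChain θ N R j)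

/-- The decreasing chain of ground sets: each one is an enlargement inside the previous one,
stopped at a prescribed time. -/
noncomputable def groundChain (θ : ℝ) (R : ℕ → ℕ → Fin T → Finset α) (σ : ℕ → ℕ) : ℕ → Finset α
  | 0 => Finset.univ
  | l + 1 => layerChain M θ (groundChain θ R σ l) (R l) (σ l)

variable {M}

omit [Fintype α] in
theorem layerChain_mono (θ : ℝ) (N : Finset α) (R : ℕ → Fin T → Finset α) :
    Monotone (layerChain M θ N R) :=
  monotone_nat_of_le_succ fun _ => Finset.subset_union_left

omit [Fintype α] in
theorem layerChain_subset (θ : ℝ) (N : Finset α) (R : ℕ → Fin T → Finset α) (j : ℕ) :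
    layerChain M θ N R j ⊆ N := by
  induction j with
  | zero => exact Finset.empty_subset _
  | succ j ih => exact Finset.union_subset ih (Finset.filter_subset _ _)

omit [Fintype α] in
theorem layerChain_congr (θ : ℝ) (N : Finset α) {R R' : ℕ → Fin T → Finset α} {j : ℕ}
    (h : ∀ j' < j, R j' = R' j') : layerChain M θ N R j = layerChain M θ N R' j := by
  induction j with
  | zero => rfl
  | succ j ih =>
    rw [layerChain, layerChain, ih fun j' hj => h j' (by omega), h j (by omega)]

theorem groundChain_antitone (θ : ℝ) (R : ℕ → ℕ → Fin T → Finset α) (σ : ℕ → ℕ) :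
    Antitone (groundChain M θ R σ) :=
  antitone_nat_of_succ_le fun _ => layerChain_subset _ _ _ _

theorem groundChain_congr (θ : ℝ) {R R' : ℕ → ℕ → Fin T → Finset α} {σ σ' : ℕ → ℕ} {l : ℕ}
    (h : ∀ l' < l, R l' = R' l') (hσ : ∀ l' < l, σ l' = σ' l') :
    groundChain M θ R σ l = groundChain M θ R' σ' l := by
  induction l with
  | zero => rfl
  | succ l ih =>
    rw [groundChain, groundChain, ih (fun l' hl => h l' (by omega)) fun l' hl => hσ l' (by omega),
      h l (by omega), hσ l (by omega)]

/-- The expected rank bound behind the shrinking of the ground sets is preserved by adding an item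
which is spanned with probability at least `b`. -/
theorem expected_rank_insert (hE : M.E = Set.univ) (ν : Measure (Finset α))
    [IsProbabilityMeasure ν] {N S S' : Finset α} {e : α} {b x : ℝ} (hS : S ⊆ S')
    (he : b ≤ spanProb M ν N S e)
    (h : ∫ R, (M.natRk ((R ∩ N ∪ S' : Finset α) : Set α) : ℝ) ∂ν ≤
      x + (1 - b) * M.natRk (S' : Set α)) :
    ∫ R, (M.natRk ((R ∩ N ∪ insert e S' : Finset α) : Set α) : ℝ) ∂ν ≤
      x + (1 - b) * M.natRk ((insert e S' : Finset α) : Set α) := by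
  have hins : ∀ R : Finset α, ((R ∩ N ∪ insert e S' : Finset α) : Set α) =
      insert e ((R ∩ N ∪ S' : Finset α) : Set α) := fun R => by
    rw [Finset.union_insert, Finset.coe_insert]
  rw [Finset.coe_insert]
  simp_rw [hins]
  by_cases hcl : e ∈ M.closure (S' : Set α)
  · have h1 : ∀ R : Finset α, e ∈ M.closure ((R ∩ N ∪ S' : Finset α) : Set α) := fun R =>
      M.closure_subset_closure (by simp) hcl
    simp_rw [Matroid.natRk_insert_of_mem hcl, Matroid.natRk_insert_of_mem (h1 _)]
    exact h
  · rw [Matroid.natRk_insert_of_notMem (by simp [hE]) hcl]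
    -- The rank of `S'` grows by 1, while that of `R ∩ N ∪ S'` can grow only outside `B`, so by at
    -- most `1 - b` on average.
    set B : Set (Finset α) := {R | e ∈ M.closure (((R ∩ N).erase e ∪ S : Finset α) : Set α)}
      with hB
    have h1 : ∀ R : Finset α, (M.natRk (insert e ((R ∩ N ∪ S' : Finset α) : Set α)) : ℝ) ≤
        M.natRk ((R ∩ N ∪ S' : Finset α) : Set α) + Bᶜ.indicator (fun _ => 1) R := by
      intro R
      by_cases hR : R ∈ B
      · have h2 : e ∈ M.closure ((R ∩ N ∪ S' : Finset α) : Set α) := by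
          refine M.closure_subset_closure ?_ hR
          exact Finset.coe_subset.2 (Finset.union_subset_union (Finset.erase_subset _ _) hS)
        rw [Matroid.natRk_insert_of_mem h2]
        simp [hR]
      · rw [Set.indicator_of_mem (by exact hR)]
        by_cases h2 : e ∈ M.closure ((R ∩ N ∪ S' : Finset α) : Set α)
        · rw [Matroid.natRk_insert_of_mem h2]; linarith
        · rw [Matroid.natRk_insert_of_notMem (by simp [hE]) h2]; push_cast; rfl
    have h3 : ∫ R, (M.natRk (insert e ((R ∩ N ∪ S' : Finset α) : Set α)) : ℝ) ∂ν ≤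
        ∫ R, (M.natRk ((R ∩ N ∪ S' : Finset α) : Set α) : ℝ) ∂ν + ν.real Bᶜ := by
      refine (integral_mono .of_finite .of_finite h1).trans (le_of_eq ?_)
      rw [integral_add .of_finite .of_finite, integral_indicator_const _ .of_discrete]
      simp
    rw [probReal_compl_eq_one_sub .of_discrete] at h3
    have h4 : b ≤ ν.real B := he
    rw [Nat.cast_add, Nat.cast_one]
    linarith

/-- The items of a whole round are tested against the same `S`, but may be added one at a time,
because the potential estimate allows any larger set `S'`. -/
theorem expected_rank_union (hE : M.E = Set.univ) (ν : Measure (Finset α))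
    [IsProbabilityMeasure ν] {N S A : Finset α} {b x : ℝ}
    (hA : ∀ e ∈ A, b ≤ spanProb M ν N S e)
    (h : ∫ R, (M.natRk ((R ∩ N ∪ S : Finset α) : Set α) : ℝ) ∂ν ≤
      x + (1 - b) * M.natRk (S : Set α)) :
    ∫ R, (M.natRk ((R ∩ N ∪ (A ∪ S) : Finset α) : Set α) : ℝ) ∂ν ≤
      x + (1 - b) * M.natRk ((A ∪ S : Finset α) : Set α) := by
  induction A using Finset.induction_on with
  | empty => simpa using h
  | insert e A _ ih =>
    rw [Finset.insert_union]
    exact expected_rank_insert hE ν Finset.subset_union_right (hA e (by simp))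
      (ih fun e' he' => hA e' (by simp [he']))

/-- The empirical frequencies of being spanned are close to the probabilities. -/
def Accurate (M : Matroid α) (ν : Measure (Finset α)) (δ : ℝ) (N S : Finset α)
    (R : Fin T → Finset α) : Prop :=
  ∀ i, |(spanCount M R N S i : ℝ) - T * spanProb M ν N S i| ≤ δ * T

/-- The potential bound starts at `∅`, where the expected rank is at most the expected number of
active items of `N`. At the end, the expected rank of the union is at least the rank of the chain
set, and the terms without the factor `θ - δ` cancel. -/
theorem natRk_layerChain_le (hE : M.E = Set.univ) (ν : Measure (Finset α))
    [IsProbabilityMeasure ν] (hT : 0 < T) {N : Finset α} {θ δ : ℝ} {R : ℕ → Fin T → Finset α}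
    {j : ℕ} (h : ∀ j' < j, Accurate M ν δ N (layerChain M θ N R j') (R j')) :
    (θ - δ) * M.natRk (layerChain M θ N R j : Set α) ≤ ∑ i ∈ N, ν.real {R | i ∈ R} := by
  have hT' : (0 : ℝ) < T := by exact_mod_cast hT
  have key : ∫ R', (M.natRk ((R' ∩ N ∪ layerChain M θ N R j : Finset α) : Set α) : ℝ) ∂ν ≤
      ∑ i ∈ N, ν.real {R | i ∈ R} + (1 - (θ - δ)) * M.natRk (layerChain M θ N R j : Set α) := by
    induction j with
    | zero =>
      simp only [layerChain, Finset.union_empty, Finset.coe_empty, Matroid.natRk_empty,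
        Nat.cast_zero, mul_zero, add_zero]
      have h1 : ∀ R' : Finset α, (M.natRk ((R' ∩ N : Finset α) : Set α) : ℝ) ≤
          ∑ i ∈ N, Set.indicator {R : Finset α | i ∈ R} (fun _ => 1) R' := by
        intro R'
        have h2 := M.natRk_le_ncard ((R' ∩ N : Finset α) : Set α)
        rw [Set.ncard_coe_finset] at h2
        refine (Nat.cast_le.2 h2).trans (le_of_eq ?_)
        rw [Finset.inter_comm, ← Finset.filter_mem_eq_inter, Finset.card_filter]
        push_cast
        refine Finset.sum_congr rfl fun i _ => ?_
        simp [Set.indicator_apply]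
      refine (integral_mono .of_finite .of_finite h1).trans (le_of_eq ?_)
      rw [integral_finsetSum _ fun i _ => .of_finite]
      refine Finset.sum_congr rfl fun i _ => ?_
      rw [integral_indicator_const _ .of_discrete]
      simp
    | succ j ih =>
      rw [layerChain, enlarge, Finset.union_comm (layerChain M θ N R j)]
      refine expected_rank_union hE ν (fun e he => ?_) (ih fun j' hj' => h j' (by omega))
      have h1 := (Finset.mem_filter.1 he).2
      have h2 := (abs_le.1 (h j (by omega) e)).2
      have h3 : (θ - δ) * T ≤ spanProb M ν N (layerChain M θ N R j) e * T := by linarith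
      exact le_of_mul_le_mul_right h3 hT'
  have h5 : (M.natRk (layerChain M θ N R j : Set α) : ℝ) ≤
      ∫ R', (M.natRk ((R' ∩ N ∪ layerChain M θ N R j : Finset α) : Set α) : ℝ) ∂ν := by
    have h6 : ∫ _, (M.natRk (layerChain M θ N R j : Set α) : ℝ) ∂ν ≤
        ∫ R', (M.natRk ((R' ∩ N ∪ layerChain M θ N R j : Finset α) : Set α) : ℝ) ∂ν := by
      refine integral_mono .of_finite .of_finite fun R' => ?_
      exact Nat.cast_le.2 (M.natRk_mono (by simp))
    simpa using h6
  linarith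

/-- In an accurate chain, every item which is not a loop and was not dropped lies in a layer in
which it is rarely spanned. -/
theorem exists_layer (hE : M.E = Set.univ) (ν : Measure (Finset α)) [IsProbabilityMeasure ν]
    (hT : 0 < T) {θ δ x : ℝ} (hδ : δ < θ) {R : ℕ → ℕ → Fin T → Finset α} {σ : ℕ → ℕ} {L J : ℕ}
    (hσ : ∀ l < L, σ l < J)
    (hacc : ∀ l < L, ∀ j < J, Accurate M ν δ (groundChain M θ R σ l)
      (layerChain M θ (groundChain M θ R σ l) (R l) j) (R l j))
    (hx : ∀ N : Finset α, ∑ i ∈ N, ν.real {R | i ∈ R} ≤ x * M.natRk (N : Set α))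
    (hx0 : 0 ≤ x) (hL : (x / (θ - δ)) ^ L * Fintype.card α < 1) {i : α} (hi : i ∉ M.closure ∅)
    (hdrop : ∀ l < L, i ∈ layerChain M θ (groundChain M θ R σ l) (R l) (σ l + 1) →
      i ∈ groundChain M θ R σ (l + 1)) :
    ∃ l < L, i ∈ groundChain M θ R σ l ∧
      i ∉ layerChain M θ (groundChain M θ R σ l) (R l) (σ l + 1) ∧
      spanProb M ν (groundChain M θ R σ l) (groundChain M θ R σ (l + 1)) i ≤ θ + δ := by
  have hT' : (0 : ℝ) < T := by exact_mod_cast hT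
  have hpos : 0 < θ - δ := by linarith
  have hrk : ∀ l ≤ L, (M.natRk (groundChain M θ R σ l : Set α) : ℝ) ≤
      (x / (θ - δ)) ^ l * Fintype.card α := by
    intro l hl
    induction l with
    | zero =>
      have := M.natRk_le_ncard (groundChain M θ R σ 0 : Set α)
      rw [Set.ncard_coe_finset] at this
      simpa using this.trans (Finset.card_le_univ _)
    | succ l ih =>
      have h1 := natRk_layerChain_le hE ν hT (N := groundChain M θ R σ l) (R := R l) (θ := θ)
        (δ := δ) (j := σ l) fun j' hj' => hacc l (by omega) j' (hj'.trans (hσ l (by omega)))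
      have h2 := hx (groundChain M θ R σ l)
      have h3 := ih (by omega)
      have h4 : (M.natRk (groundChain M θ R σ (l + 1) : Set α) : ℝ) ≤
          x / (θ - δ) * M.natRk (groundChain M θ R σ l : Set α) := by
        rw [div_mul_eq_mul_div, le_div_iff₀ hpos, mul_comm]
        exact h1.trans h2
      calc _ ≤ _ := h4
        _ ≤ x / (θ - δ) * ((x / (θ - δ)) ^ l * Fintype.card α) := by gcongr
        _ = _ := by ring
  have h0 : M.natRk (groundChain M θ R σ L : Set α) = 0 := by
    have := (hrk L le_rfl).trans_lt hL
    have h1 : M.natRk (groundChain M θ R σ L : Set α) < 1 := by exact_mod_cast this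
    omega
  have hiL : i ∉ groundChain M θ R σ L := fun h =>
    Matroid.notMem_of_natRk_eq_zero hE h0 hi h
  classical
  -- The layer of `i` is the last one whose ground set contains it. As `i` is not dropped, it also
  -- fails the test of round `σ l`, so its empirical frequency there is at most `θ`.
  have hex : ∃ l, i ∉ groundChain M θ R σ l := ⟨L, hiL⟩
  obtain ⟨l, hl⟩ : ∃ l, Nat.find hex = l + 1 := by
    refine Nat.exists_eq_succ_of_ne_zero fun h => ?_
    have := Nat.find_spec hex
    rw [h] at this
    exact this (by simp [groundChain])
  have hlL : l < L := by
    have := Nat.find_min' hex hiL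
    omega
  have hil : i ∈ groundChain M θ R σ l := by
    by_contra h
    have := Nat.find_min' hex h
    omega
  have hil1 : i ∉ groundChain M θ R σ (l + 1) := hl ▸ Nat.find_spec hex
  have hnd : i ∉ layerChain M θ (groundChain M θ R σ l) (R l) (σ l + 1) := fun h =>
    hil1 (hdrop l hlL h)
  refine ⟨l, hlL, hil, hnd, ?_⟩
  rw [layerChain, enlarge, Finset.mem_union, Finset.mem_filter] at hnd
  push Not at hnd
  have h1 := hnd.2 hil
  have h2 := (abs_le.1 (hacc l hlL (σ l) (hσ l hlL) i)).1
  have h3 : spanProb M ν (groundChain M θ R σ l) (groundChain M θ R σ (l + 1)) i * T ≤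
      (θ + δ) * T := by
    rw [groundChain]
    linarith
  exact le_of_mul_le_mul_right h3 hT'

-- Hoeffding's inequality, one-sided.
omit [Fintype α] [DecidableEq α] in
theorem measure_sum_ge_le_of_mem_Icc {X : Type*} [MeasurableSpace X] (μ : Measure X)
    [IsProbabilityMeasure μ] {f : X → ℝ} (hf : Measurable f) (h0 : ∀ x, f x ∈ Set.Icc 0 1) {δ : ℝ}
    (hδ : 0 ≤ δ) :
    (Measure.pi fun _ : Fin T => μ) {ω | δ * T ≤ ∑ t, f (ω t) - T * ∫ x, f x ∂μ} ≤
      ENNReal.ofReal (Real.exp (-(2 * δ ^ 2 * T))) := by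
  have hind := ProbabilityTheory.iIndepFun_pi (μ := fun _ : Fin T => μ)
    (X := fun _ x => f x - ∫ x, f x ∂μ) fun _ => (hf.sub_const _).aemeasurable
  have hsub : ∀ t ∈ (Finset.univ : Finset (Fin T)), ProbabilityTheory.HasSubgaussianMGF
      (fun ω : Fin T → X => f (ω t) - ∫ x, f x ∂μ) (1 / 4) (Measure.pi fun _ : Fin T => μ) := by
    intro t _
    have h1 := ProbabilityTheory.hasSubgaussianMGF_of_mem_Icc (μ := μ) hf.aemeasurable
      (.of_forall h0)
    have h2 : ((‖(1 : ℝ) - 0‖₊ / 2) ^ 2 : ℝ≥0) = 1 / 4 := by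
      rw [sub_zero, nnnorm_one]; norm_num
    rw [h2] at h1
    refine ProbabilityTheory.HasSubgaussianMGF.of_map (μ := Measure.pi fun _ : Fin T => μ)
      (Y := Function.eval t) (X := fun x => f x - ∫ x, f x ∂μ)
      (measurable_pi_apply t).aemeasurable ?_
    rwa [(measurePreserving_eval (fun _ : Fin T => μ) t).map_eq]
  have h := ProbabilityTheory.HasSubgaussianMGF.measure_sum_ge_le_of_iIndepFun hind hsub
    (ε := δ * T) (by positivity)
  have h4 : {ω : Fin T → X | δ * T ≤ ∑ t, f (ω t) - T * ∫ x, f x ∂μ} =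
      {ω | δ * T ≤ ∑ t, (f (ω t) - ∫ x, f x ∂μ)} := by
    ext ω
    simp
  rw [h4, ← ofReal_measureReal]
  refine ENNReal.ofReal_le_ofReal (h.trans (le_of_eq ?_))
  congr 1
  rcases Nat.eq_zero_or_pos T with rfl | hT
  · simp
  · have hT' : (T : ℝ) ≠ 0 := by positivity
    simp
    field_simp
    ring

theorem measure_not_accurate_le (ν : Measure (Finset α)) [IsProbabilityMeasure ν] {δ : ℝ}
    (hδ : 0 ≤ δ) (N S : Finset α) :
    (Measure.pi fun _ : Fin T => ν) {R | ¬ Accurate M ν δ N S R} ≤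
      ENNReal.ofReal (Fintype.card α * (2 * Real.exp (-(2 * δ ^ 2 * T)))) := by
  classical
  let f : α → Finset α → ℝ := fun i => Set.indicator
    {R | i ∈ M.closure (((R ∩ N).erase i ∪ S : Finset α) : Set α)} (fun _ => 1)
  have hf0 : ∀ i R, f i R ∈ Set.Icc (0 : ℝ) 1 := fun i R =>
    ⟨Set.indicator_nonneg (fun _ _ => zero_le_one) _,
      Set.indicator_le_self' (fun _ _ => zero_le_one) _⟩
  have hint : ∀ i, ∫ R, f i R ∂ν = spanProb M ν N S i := fun i => by
    simp only [f]
    rw [integral_indicator_const _ .of_discrete]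
    simp [spanProb]
  have hcount : ∀ i (R : Fin T → Finset α), (spanCount M R N S i : ℝ) = ∑ t, f i (R t) := by
    intro i R
    simp [spanCount, f, Set.indicator_apply]
  have hcard : ENNReal.ofReal (Fintype.card α * (2 * Real.exp (-(2 * δ ^ 2 * T)))) =
      ∑ _i : α, (ENNReal.ofReal (Real.exp (-(2 * δ ^ 2 * T))) +
        ENNReal.ofReal (Real.exp (-(2 * δ ^ 2 * T)))) := by
    rw [Finset.sum_const, Finset.card_univ, nsmul_eq_mul, ← ENNReal.ofReal_add (by positivity)
      (by positivity), ← ENNReal.ofReal_natCast, ← ENNReal.ofReal_mul (by positivity), two_mul]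
  -- The lower tail of `f i` is the upper tail of `1 - f i`.
  have hsub : {R : Fin T → Finset α | ¬ Accurate M ν δ N S R} ⊆
      ⋃ i ∈ (Finset.univ : Finset α), ({R | δ * T ≤ ∑ t, f i (R t) - T * ∫ R, f i R ∂ν} ∪
        {R | δ * T ≤ ∑ t, (1 - f i (R t)) - T * ∫ R, (1 - f i R) ∂ν}) := by
    intro R hR
    simp only [Set.mem_ofPred_eq, Accurate, not_forall, not_le] at hR
    obtain ⟨i, hi⟩ := hR
    simp only [Set.mem_iUnion, Finset.mem_univ, exists_prop, true_and]
    refine ⟨i, ?_⟩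
    rw [hcount] at hi
    have h1 : ∫ R, (1 - f i R) ∂ν = 1 - ∫ R, f i R ∂ν := by
      rw [integral_sub .of_finite .of_finite]; simp
    rcases le_abs'.1 hi.le with h | h
    · right
      rw [Set.mem_ofPred_eq, h1, hint]
      simp only [Finset.sum_sub_distrib, Finset.sum_const, Finset.card_univ, Fintype.card_fin,
        nsmul_eq_mul, mul_one]
      linarith
    · left
      rw [Set.mem_ofPred_eq, hint]
      exact h
  refine (measure_mono hsub).trans ((measure_biUnion_finset_le _ _).trans ?_)
  rw [hcard]
  refine Finset.sum_le_sum fun i _ => (measure_union_le _ _).trans (add_le_add ?_ ?_)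
  · exact measure_sum_ge_le_of_mem_Icc ν .of_discrete (hf0 i) hδ
  · refine measure_sum_ge_le_of_mem_Icc ν .of_discrete (f := fun R => 1 - f i R) (fun R => ?_) hδ
    have := hf0 i R
    exact ⟨by linarith [this.2], by linarith [this.1]⟩

/-- A family of lists of sets indexed by finitely many layers and rounds, extended by junk. -/
def extendRounds {L J : ℕ} (C : Fin L × Fin J → Fin T → Finset α) (l j : ℕ) : Fin T → Finset α :=
  if h : l < L ∧ j < J then C (⟨l, h.1⟩, ⟨j, h.2⟩) else fun _ => ∅

/-- The stopping times of finitely many layers, extended by zero. -/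
def extendStops {L J : ℕ} (σ : Fin L → Fin J) (l : ℕ) : ℕ :=
  if h : l < L then σ ⟨l, h⟩ else 0

omit [Fintype α] [DecidableEq α] in
theorem extendRounds_update {L J : ℕ} (C : Fin L × Fin J → Fin T → Finset α) (l : Fin L)
    (j : Fin J) (R : Fin T → Finset α) {l' j' : ℕ} (h : ¬ (l' = l ∧ j' = j)) :
    extendRounds (Function.update C (l, j) R) l' j' = extendRounds C l' j' := by
  unfold extendRounds
  split_ifs with hb
  · rw [Function.update_of_ne]
    intro he
    rw [Prod.mk.injEq, Fin.ext_iff, Fin.ext_iff] at he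
    exact h he
  · rfl

variable (M) in
/-- All the rounds of the chain are accurate. -/
def ChainAccurate (ν : Measure (Finset α)) (θ δ : ℝ) {L J : ℕ} (σ : Fin L → Fin J)
    (C : Fin L × Fin J → Fin T → Finset α) : Prop :=
  ∀ l < L, ∀ j < J, Accurate M ν δ (groundChain M θ (extendRounds C) (extendStops σ) l)
    (layerChain M θ (groundChain M θ (extendRounds C) (extendStops σ) l) (extendRounds C l) j)
    (extendRounds C l j)

/-- Fresh samples in each round make the estimated sets independent of the lists that test them.
With all other lists fixed, `N` and `S` are fixed, and Hoeffding's bound is needed only for them and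
not for all pairs of sets. -/
theorem measure_not_chainAccurate_le (ν : Measure (Finset α)) [IsProbabilityMeasure ν]
    {θ δ : ℝ} (hδ : 0 ≤ δ) {L J : ℕ} (σ : Fin L → Fin J) :
    (Measure.pi fun _ : Fin L × Fin J => Measure.pi fun _ : Fin T => ν)
      {C | ¬ ChainAccurate M ν θ δ σ C} ≤
      ENNReal.ofReal (L * J * (Fintype.card α * (2 * Real.exp (-(2 * δ ^ 2 * T))))) := by
  classical
  let Bad : Fin L × Fin J → Set (Fin L × Fin J → Fin T → Finset α) := fun p =>
    {C | ¬ Accurate M ν δ (groundChain M θ (extendRounds C) (extendStops σ) p.1)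
      (layerChain M θ (groundChain M θ (extendRounds C) (extendStops σ) p.1)
        (extendRounds C p.1) p.2) (C p)}
  have hsub : {C : Fin L × Fin J → Fin T → Finset α | ¬ ChainAccurate M ν θ δ σ C} ⊆
      ⋃ p ∈ (Finset.univ : Finset (Fin L × Fin J)), Bad p := by
    intro C hC
    simp only [Set.mem_ofPred_eq, ChainAccurate, not_forall] at hC
    obtain ⟨l, hl, j, hj, h⟩ := hC
    simp only [Set.mem_iUnion, Finset.mem_univ, exists_prop, true_and]
    refine ⟨(⟨l, hl⟩, ⟨j, hj⟩), ?_⟩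
    have h1 : extendRounds C l j = C (⟨l, hl⟩, ⟨j, hj⟩) := dif_pos ⟨hl, hj⟩
    rw [h1] at h
    exact h
  have hcard : ENNReal.ofReal (L * J * (Fintype.card α * (2 * Real.exp (-(2 * δ ^ 2 * T))))) =
      ∑ _p : Fin L × Fin J,
        ENNReal.ofReal (Fintype.card α * (2 * Real.exp (-(2 * δ ^ 2 * T)))) := by
    rw [Finset.sum_const, Finset.card_univ, Fintype.card_prod, Fintype.card_fin, Fintype.card_fin,
      nsmul_eq_mul, ← ENNReal.ofReal_natCast, ← ENNReal.ofReal_mul (by positivity), Nat.cast_mul]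
  refine (measure_mono hsub).trans ((measure_biUnion_finset_le _ _).trans ?_)
  rw [hcard]
  refine Finset.sum_le_sum fun p _ => ?_
  refine measure_pi_le_of_section_le (fun _ : Fin L × Fin J => Measure.pi fun _ : Fin T => ν) p
    .of_discrete fun C => ?_
  have hg : ∀ R, groundChain M θ (extendRounds (Function.update C p R)) (extendStops σ) p.1 =
      groundChain M θ (extendRounds C) (extendStops σ) p.1 := fun R =>
    groundChain_congr θ (fun l' hl' => by
      funext j'
      exact extendRounds_update C p.1 p.2 R (by omega)) fun _ _ => rfl
  have hl : ∀ R, layerChain M θ (groundChain M θ (extendRounds C) (extendStops σ) p.1)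
        (extendRounds (Function.update C p R) p.1) p.2 =
      layerChain M θ (groundChain M θ (extendRounds C) (extendStops σ) p.1)
        (extendRounds C p.1) p.2 := fun R =>
    layerChain_congr θ _ fun j' hj' => extendRounds_update C p.1 p.2 R (by omega)
  have hset : {R | Function.update C p R ∈ Bad p} = {R | ¬ Accurate M ν δ
      (groundChain M θ (extendRounds C) (extendStops σ) p.1)
      (layerChain M θ (groundChain M θ (extendRounds C) (extendStops σ) p.1)
        (extendRounds C p.1) p.2) R} := by
    ext R
    simp only [Bad, Set.mem_ofPred_eq, hg, hl, Function.update_self]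
  rw [hset]
  exact measure_not_accurate_le ν hδ _ _

variable (M) in
/-- An item is dropped if it would have been added to the next ground set, had the enlargement gone
on for one more round. -/
def Dropped (θ : ℝ) {L J : ℕ} (σ : Fin L → Fin J) (C : Fin L × Fin J → Fin T → Finset α)
    (i : α) : Prop :=
  ∃ l < L, i ∈ layerChain M θ (groundChain M θ (extendRounds C) (extendStops σ) l)
      (extendRounds C l) (extendStops σ l + 1) ∧
    i ∉ groundChain M θ (extendRounds C) (extendStops σ) (l + 1)

/-- The first `l` stopping times determine ground set `l`. Given it, `i` enters the increasing chain
in at most one round, and is dropped only if `σ l` is the round just before its entry: one of `J`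
equally likely values. -/
theorem measure_dropped_le (θ : ℝ) {L J : ℕ} [NeZero J] (C : Fin L × Fin J → Fin T → Finset α)
    (i : α) :
    (Measure.pi fun _ : Fin L => uniformMeasure (Fin J)) {σ | Dropped M θ σ C i} ≤
      ENNReal.ofReal (L / J) := by
  classical
  have hJ : (0 : ℝ) < J := by exact_mod_cast Nat.pos_of_ne_zero (NeZero.ne J)
  let Bad : Fin L → Set (Fin L → Fin J) := fun l =>
    {σ | i ∈ layerChain M θ (groundChain M θ (extendRounds C) (extendStops σ) l)
      (extendRounds C l) (σ l + 1) ∧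
      i ∉ layerChain M θ (groundChain M θ (extendRounds C) (extendStops σ) l)
      (extendRounds C l) (σ l)}
  have hsub : {σ : Fin L → Fin J | Dropped M θ σ C i} ⊆
      ⋃ l ∈ (Finset.univ : Finset (Fin L)), Bad l := by
    rintro σ ⟨l, hl, h1, h2⟩
    simp only [Set.mem_iUnion, Finset.mem_univ, exists_prop, true_and]
    have h3 : extendStops σ l = σ ⟨l, hl⟩ := dif_pos hl
    rw [groundChain] at h2
    rw [h3] at h1 h2
    exact ⟨⟨l, hl⟩, h1, h2⟩
  have hcard : ENNReal.ofReal (L / J) = ∑ _l : Fin L, ((J : ℝ≥0∞))⁻¹ := by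
    rw [Finset.sum_const, Finset.card_univ, Fintype.card_fin, nsmul_eq_mul,
      ENNReal.ofReal_div_of_pos hJ, ENNReal.ofReal_natCast, ENNReal.ofReal_natCast,
      div_eq_mul_inv]
  refine (measure_mono hsub).trans ((measure_biUnion_finset_le _ _).trans ?_)
  rw [hcard]
  refine Finset.sum_le_sum fun l _ => ?_
  refine measure_pi_le_of_section_le (fun _ : Fin L => uniformMeasure (Fin J)) l
    .of_discrete fun σ => ?_
  have hg : ∀ x, groundChain M θ (extendRounds C) (extendStops (Function.update σ l x)) l =
      groundChain M θ (extendRounds C) (extendStops σ) l := fun x =>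
    groundChain_congr θ (fun _ _ => rfl) fun l' hl' => by
      have hlL : l' < L := hl'.trans l.2
      simp only [extendStops, hlL, dif_pos]
      rw [Function.update_of_ne]
      intro h
      rw [Fin.ext_iff] at h
      simp at h
      omega
  set Q := layerChain M θ (groundChain M θ (extendRounds C) (extendStops σ) l)
    (extendRounds C l) with hQ
  have hmono : Monotone Q := layerChain_mono _ _ _
  have hsingle : ({x | Function.update σ l x ∈ Bad l} : Set (Fin J)).Subsingleton := by
    intro x hx y hy
    simp only [Bad, Set.mem_ofPred_eq, hg, Function.update_self] at hx hy
    rcases lt_trichotomy x y with h | h | h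
    · exact absurd (hmono (show (x : ℕ) + 1 ≤ y from h) hx.1) hy.2
    · exact h
    · exact absurd (hmono (show (y : ℕ) + 1 ≤ x from h) hy.1) hx.2
  rcases hsingle.eq_empty_or_singleton with h | ⟨x, h⟩
  · rw [h]; simp
  · rw [h, uniformMeasure_singleton, Fintype.card_fin]

end Chain

/-! ### The expected greedy weight and its truncations. -/

section Greedy

variable {α : Type*} [LinearOrder α] [Fintype α] {M : Matroid α}

/-- The basis sorts by `u` while the weights are `w ∘ u`; monotonicity of `w` suffices. This permits
truncated weights in the analysis while the algorithm compares the true values. -/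
theorem sum_le_sum_indicator_greedy (hE : M.E = Set.univ) (u : α → ℝ≥0) {w : ℝ≥0 → ℝ≥0}
    (hw : Monotone w) {S : Finset α} (hS : M.Indep (S : Set α)) :
    ∑ i ∈ S, (w (u i) : ℝ≥0∞) ≤
      ∑ i, Set.indicator {u | i ∈ greedy M u} (fun u => (w (u i) : ℝ≥0∞)) u := by
  classical
  have h := sum_le_sum_greedy hE u (fun i => (w (u i) : ℝ)) (fun i => (w (u i)).2)
    (fun i j hij => NNReal.coe_le_coe.2 (hw hij)) hS
  have h1 : ∑ i ∈ S, w (u i) ≤ ∑ i with i ∈ greedy M u, w (u i) := by exact_mod_cast h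
  have h2 : ∑ i, Set.indicator {u | i ∈ greedy M u} (fun u => (w (u i) : ℝ≥0∞)) u =
      ((∑ i with i ∈ greedy M u, w (u i) : ℝ≥0) : ℝ≥0∞) := by
    rw [Finset.sum_filter, ENNReal.ofNNReal_finsetSum]
    refine Finset.sum_congr rfl fun i _ => ?_
    simp only [Set.indicator_apply, Set.mem_ofPred_eq]
    split_ifs <;> rfl
  rw [h2]
  exact_mod_cast h1

/-- The expected weight of the greedy basis. -/
noncomputable def greedyValue (M : Matroid α) (D : α → Measure ℝ≥0) (w : ℝ≥0 → ℝ≥0) : ℝ≥0∞ :=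
  ∑ i, ∫⁻ u, Set.indicator {u | i ∈ greedy M u} (fun u => (w (u i) : ℝ≥0∞)) u ∂Measure.pi D

theorem measurable_indicator_greedy {w : ℝ≥0 → ℝ≥0} (hw : Measurable w) (i : α) :
    Measurable (Set.indicator {u : α → ℝ≥0 | i ∈ greedy M u} fun u => (w (u i) : ℝ≥0∞)) :=
  (hw.comp (measurable_pi_apply i)).coe_nnreal_ennreal.indicator (measurableSet_mem_greedy M i)

variable {D : α → Measure ℝ≥0} [∀ i, IsProbabilityMeasure (D i)]

theorem lintegral_le_greedyValue (hE : M.E = Set.univ) {w : ℝ≥0 → ℝ≥0} (hw : Monotone w) {i : α}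
    (hi : i ∉ M.closure ∅) : ∫⁻ v, (w v : ℝ≥0∞) ∂D i ≤ greedyValue M D w := by
  have hwm : Measurable w := hw.measurable
  rw [greedyValue, ← lintegral_finsetSum _ fun i _ => measurable_indicator_greedy hwm i,
    ← (measurePreserving_eval D i).lintegral_comp (f := fun v => (w v : ℝ≥0∞)) (by fun_prop)]
  refine lintegral_mono fun u => ?_
  have hS : M.Indep (({i} : Finset α) : Set α) := by
    rw [Finset.coe_singleton, Matroid.indep_singleton]
    rw [Matroid.isNonloop_iff_notMem_loops (by simp [hE])]
    exact hi
  simpa using sum_le_sum_indicator_greedy hE u hw hS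

theorem greedyValue_min_lt_top (B : ℝ≥0) : greedyValue M D (fun v => min v B) < ⊤ := by
  refine ENNReal.sum_lt_top.2 fun i _ => ?_
  calc _ ≤ ∫⁻ _, (B : ℝ≥0∞) ∂Measure.pi D := lintegral_mono fun u => by
        refine (Set.indicator_le_self _ _ _).trans ?_
        exact ENNReal.coe_le_coe.2 (min_le_right _ _)
    _ < ⊤ := by simp

omit [∀ i, IsProbabilityMeasure (D i)] in
theorem iSup_greedyValue_min : greedyValue M D id ≤ ⨆ B : ℕ, greedyValue M D fun v => min v B := by
  have hm : ∀ B : ℕ, ∀ i, Measurable (Set.indicator {u : α → ℝ≥0 | i ∈ greedy M u}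
      fun u => ((min (u i) B : ℝ≥0) : ℝ≥0∞)) := fun B i =>
    measurable_indicator_greedy (w := fun v => min v B) (by fun_prop) i
  have h1 : ∀ B : ℕ, greedyValue M D (fun v => min v B) = ∫⁻ u, ∑ i, Set.indicator
      {u | i ∈ greedy M u} (fun u => ((min (u i) B : ℝ≥0) : ℝ≥0∞)) u ∂Measure.pi D := fun B => by
    rw [lintegral_finsetSum _ fun i _ => hm B i]; rfl
  simp_rw [h1]
  rw [← lintegral_iSup (fun B => Finset.measurable_sum _ fun i _ => hm B i), greedyValue,
    ← lintegral_finsetSum _ fun i _ => measurable_indicator_greedy measurable_id i]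
  · refine lintegral_mono fun u => ?_
    -- For each fixed `u` a large enough truncation changes nothing.
    obtain ⟨B, hB⟩ := exists_nat_ge (∑ i, u i)
    refine le_trans (le_of_eq ?_) (le_iSup _ B)
    refine Finset.sum_congr rfl fun i _ => ?_
    have h2 : min (u i) B = u i :=
      min_eq_left ((Finset.single_le_sum (f := u) (fun _ _ => zero_le)
        (Finset.mem_univ i)).trans hB)
    have h3 : ∀ f g : (α → ℝ≥0) → ℝ≥0∞, f u = g u → Set.indicator {u | i ∈ greedy M u} f u =
        Set.indicator {u | i ∈ greedy M u} g u := fun f g h => by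
      classical
      simp only [Set.indicator_apply, h]
    exact h3 _ _ (by simp [h2])
  · intro B B' hBB' u
    refine Finset.sum_le_sum fun i _ => Set.indicator_le_indicator ?_
    have : (B : ℝ≥0) ≤ B' := by exact_mod_cast hBB'
    exact ENNReal.coe_le_coe.2 (min_le_min_left _ this)

end Greedy

theorem prophetValue_le_greedyValue {n : ℕ} {M : Matroid (Fin n)} (hE : M.E = Set.univ)
    (D : Fin n → Measure ℝ≥0) [∀ i, IsProbabilityMeasure (D i)] :
    prophetValue M.indepFamily D ≤ greedyValue M D id := by
  rw [prophetValue, greedyValue,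
    ← lintegral_finsetSum _ fun i _ => measurable_indicator_greedy measurable_id i]
  refine lintegral_mono fun u => iSup₂_le fun S hS => ?_
  exact sum_le_sum_indicator_greedy hE u monotone_id hS

/-! ### The selection rule: feasibility and the probability of being selected. -/

section Selection

variable {α : Type*} [LinearOrder α] [Fintype α] (M : Matroid α) {k m T L J : ℕ}

open scoped Classical in
/-- The set of the active items. -/
noncomputable def activeSet (ρ : Fin m → Block k α) (x : α → ℝ≥0 × Coin m) : Finset α :=
  Finset.univ.filter fun i => Active M ρ i (x i)

theorem mem_activeSet {ρ : Fin m → Block k α} {x : α → ℝ≥0 × Coin m} {i : α} :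
    i ∈ activeSet M ρ x ↔ Active M ρ i (x i) := by
  simp [activeSet]

theorem measurable_activeSet : Measurable
    fun p : (Fin m → Block k α) × (α → ℝ≥0 × Coin m) => activeSet M p.1 p.2 := by
  refine measurable_finset_of_mem fun i => ?_
  simp_rw [mem_activeSet]
  have h1 : Measurable fun p : (Fin m → Block k α) × (α → ℝ≥0 × Coin m) => (p.1, p.2 i) := by
    fun_prop
  exact h1 (measurableSet_active_prod M i)

theorem measurable_activeSet_right (ρ : Fin m → Block k α) : Measurable (activeSet M ρ) := by
  have h1 : Measurable fun x : α → ℝ≥0 × Coin m => (ρ, x) := by fun_prop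
  exact (measurable_activeSet M).comp h1

/-- The distribution of the set of the active items. -/
noncomputable def activeLaw (D : α → Measure ℝ≥0) (ρ : Fin m → Block k α) : Measure (Finset α) :=
  (Measure.pi (itemMeasure m D)).map (activeSet M ρ)

/-- The item `i` is selected if it is active, not dropped, and not spanned, in its layer, by the
active items which arrived before. -/
def Selected (θ : ℝ) (σ : Fin L → Fin J) (C : Fin L × Fin J → Fin T → Finset α) (R : Finset α)
    (i : α) : Prop :=
  i ∈ R ∧ ∃ l < L, i ∈ groundChain M θ (extendRounds C) (extendStops σ) l ∧
    i ∉ layerChain M θ (groundChain M θ (extendRounds C) (extendStops σ) l) (extendRounds C l)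
      (extendStops σ l + 1) ∧
    i ∉ M.closure ((R.filter (· < i) ∩ groundChain M θ (extendRounds C) (extendStops σ) l ∪
      groundChain M θ (extendRounds C) (extendStops σ) (l + 1) : Finset α) : Set α)

variable {M}

theorem selected_congr {θ : ℝ} {σ : Fin L → Fin J} {C : Fin L × Fin J → Fin T → Finset α}
    {R R' : Finset α} {i : α} (h : ∀ j ≤ i, j ∈ R ↔ j ∈ R') :
    Selected M θ σ C R i ↔ Selected M θ σ C R' i := by
  have : R.filter (· < i) = R'.filter (· < i) := by
    ext j
    simp only [Finset.mem_filter]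
    exact and_congr_left fun hj => h j hj.le
  simp only [Selected, this, h i le_rfl]

-- In a circuit of selected items, take the last arrival among those in the outermost layer. The
-- other items of the circuit span it, and each is either an earlier active item of its layer or
-- lies in the next ground set, which the rule forbids.
open scoped Classical in
theorem indep_selected (hE : M.E = Set.univ) {θ : ℝ} {σ : Fin L → Fin J}
    {C : Fin L × Fin J → Fin T → Finset α} {R : Finset α} :
    M.Indep ((Finset.univ.filter fun i => Selected M θ σ C R i : Finset α) : Set α) := by
  set N := groundChain M θ (extendRounds C) (extendStops σ) with hN
  have hanti : Antitone N := groundChain_antitone _ _ _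
  rw [Matroid.indep_iff_forall_subset_not_isCircuit (by simp [hE])]
  intro Q hQ hcirc
  have hsel : ∀ i ∈ Q, Selected M θ σ C R i := fun i hi => by simpa using hQ hi
  have hlay : ∀ i ∈ Q, ∃ l, i ∈ N l ∧ i ∉ N (l + 1) ∧
      i ∉ M.closure ((R.filter (· < i) ∩ N l ∪ N (l + 1) : Finset α) : Set α) := by
    intro i hi
    obtain ⟨-, l, -, h1, -, h3⟩ := hsel i hi
    refine ⟨l, h1, fun h => h3 (M.mem_closure_of_mem' ?_ (by simp [hE])), h3⟩
    exact Finset.mem_coe.2 (Finset.mem_union_right _ h)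
  choose! lay hlay using hlay
  obtain ⟨i₀, hi₀, hmin⟩ := Set.exists_min_image Q lay Q.toFinite hcirc.nonempty
  obtain ⟨i, ⟨hiQ, hil⟩, hmax⟩ := Set.exists_max_image {i ∈ Q | lay i = lay i₀} id
    (Set.toFinite _) ⟨i₀, hi₀, rfl⟩
  refine (hlay i hiQ).2.2 (M.closure_subset_closure ?_
    (hcirc.mem_closure_sdiff_singleton_of_mem hiQ))
  rintro j ⟨hjQ, hji⟩
  have hji' : j ≠ i := hji
  simp only [Finset.coe_union, Set.mem_union, Finset.mem_coe, Finset.mem_inter, Finset.mem_filter]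
  have hle : lay i ≤ lay j := hil ▸ hmin j hjQ
  rcases hle.eq_or_lt with h | h
  · left
    have h1 : j ≤ i := hmax j ⟨hjQ, h ▸ hil⟩
    exact ⟨⟨(hsel j hjQ).1, lt_of_le_of_ne h1 hji'⟩, h ▸ (hlay j hjQ).1⟩
  · right
    exact hanti (show lay i + 1 ≤ lay j from h) (hlay j hjQ).1

variable {D : α → Measure ℝ≥0} [∀ i, IsProbabilityMeasure (D i)]

instance [NeZero m] (ρ : Fin m → Block k α) : IsProbabilityMeasure (activeLaw M D ρ) :=
  Measure.isProbabilityMeasure_map (measurable_activeSet_right M ρ).aemeasurable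

theorem activeLaw_real_mem [NeZero m] (ρ : Fin m → Block k α) (i : α) :
    (activeLaw M D ρ).real {R | i ∈ R} = (itemMeasure m D i).real {x | Active M ρ i x} := by
  rw [measureReal_def, activeLaw, Measure.map_apply (measurable_activeSet_right M ρ) .of_discrete,
    measureReal_def, ← (measurePreserving_eval (itemMeasure m D) i).measure_preimage
      (measurableSet_active M ρ i).nullMeasurableSet]
  congr 2
  ext x
  simp [mem_activeSet]

/-- The expected value of an item, counted only if it is active. -/
noncomputable def activeValue (M : Matroid α) (D : α → Measure ℝ≥0) (w : ℝ≥0 → ℝ≥0)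
    (ρ : Fin m → Block k α) (i : α) : ℝ≥0∞ :=
  ∫⁻ x, Set.indicator {x | Active M ρ i x} (fun x => (w x.1 : ℝ≥0∞)) x ∂itemMeasure m D i

/-- In its layer `i` is blocked with probability at most `θ + δ`, even by all other active items
rather than only the earlier ones. That event does not involve the value and coin of `i`, so it is
independent of the active value. -/
theorem lintegral_selected_ge_of_accurate [NeZero m] (hE : M.E = Set.univ) (hT : 0 < T)
    {θ δ δ' : ℝ} {ρ : Fin m → Block k α} (hρ : WellSpread M D δ' ρ) (hδ : δ < θ) (hδ' : 0 ≤ δ')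
    (hL : ((1 + δ') / 2 / (θ - δ)) ^ L * Fintype.card α < 1) {w : ℝ≥0 → ℝ≥0} (hw : Measurable w)
    {σ : Fin L → Fin J} {C : Fin L × Fin J → Fin T → Finset α}
    (hacc : ChainAccurate M (activeLaw M D ρ) θ δ σ C) {i : α} (hi : i ∉ M.closure ∅)
    (hdrop : ¬ Dropped M θ σ C i) :
    ENNReal.ofReal (1 - (θ + δ)) * activeValue M D w ρ i ≤
      ∫⁻ x, Set.indicator {x | Selected M θ σ C (activeSet M ρ x) i}
        (fun x => (w (x i).1 : ℝ≥0∞)) x ∂Measure.pi (itemMeasure m D) := by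
  classical
  obtain ⟨l, hl, h1, h2, h3⟩ := exists_layer hE (activeLaw M D ρ) hT hδ
    (R := extendRounds C) (σ := extendStops σ) (L := L) (J := J) (x := (1 + δ') / 2)
    (fun l hl => by simp only [extendStops, hl, dif_pos]; exact (σ ⟨l, hl⟩).2) hacc
    (fun N => by
      simp_rw [activeLaw_real_mem]
      exact sum_measure_active_le M ρ hρ N) (by positivity) hL hi
    (fun l hl h => by
      by_contra h'
      exact hdrop ⟨l, hl, h, h'⟩)
  set N := groundChain M θ (extendRounds C) (extendStops σ) l with hN
  set S := groundChain M θ (extendRounds C) (extendStops σ) (l + 1) with hS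
  let B : Set (Finset α) := {R | i ∈ M.closure (((R ∩ N).erase i ∪ S : Finset α) : Set α)}
  have hmact := measurable_activeSet_right M ρ
  have hmf : Measurable (Set.indicator {x | Active M ρ i x}
      (fun x : ℝ≥0 × Coin m => (w x.1 : ℝ≥0∞))) :=
    (hw.comp measurable_fst).coe_nnreal_ennreal.indicator (measurableSet_active M ρ i)
  have hmg : Measurable (Set.indicator (activeSet M ρ ⁻¹' Bᶜ) (fun _ => (1 : ℝ≥0∞))) :=
    measurable_const.indicator (hmact .of_discrete)
  -- Erasing `i` in the definition of `spanProb` is what makes the event independent of coordinate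
  -- `i`.
  have hinv : ∀ x y, Set.indicator (activeSet M ρ ⁻¹' Bᶜ) (fun _ => (1 : ℝ≥0∞))
      (Function.update x i y) = Set.indicator (activeSet M ρ ⁻¹' Bᶜ) (fun _ => (1 : ℝ≥0∞)) x := by
    intro x y
    have : (activeSet M ρ (Function.update x i y) ∩ N).erase i =
        (activeSet M ρ x ∩ N).erase i := by
      ext j
      simp only [Finset.mem_erase, Finset.mem_inter, mem_activeSet]
      refine and_congr_right fun hj => ?_
      rw [Function.update_of_ne hj]
    simp only [Set.indicator_apply, Set.mem_preimage, Set.mem_compl_iff, B, Set.mem_ofPred_eq, this]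
  have hprod := lintegral_pi_mul_of_update (itemMeasure m D) i hmf hmg hinv
  have hB : ENNReal.ofReal (1 - (θ + δ)) ≤
      ∫⁻ x, Set.indicator (activeSet M ρ ⁻¹' Bᶜ) (fun _ => (1 : ℝ≥0∞)) x
        ∂Measure.pi (itemMeasure m D) := by
    rw [lintegral_indicator_const (hmact .of_discrete), one_mul,
      ← Measure.map_apply hmact .of_discrete]
    change _ ≤ activeLaw M D ρ Bᶜ
    rw [← ofReal_measureReal, probReal_compl_eq_one_sub .of_discrete]
    refine ENNReal.ofReal_le_ofReal ?_
    have : (activeLaw M D ρ).real B ≤ θ + δ := h3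
    linarith
  calc _ ≤ activeValue M D w ρ i * ∫⁻ x, Set.indicator (activeSet M ρ ⁻¹' Bᶜ)
          (fun _ => (1 : ℝ≥0∞)) x ∂Measure.pi (itemMeasure m D) := by
        rw [mul_comm]
        gcongr
    _ = _ := hprod.symm
    _ ≤ _ := by
      refine lintegral_mono fun x => ?_
      simp only [Set.indicator_apply, Set.mem_ofPred_eq, Set.mem_preimage, Set.mem_compl_iff, B]
      by_cases hx : Active M ρ i (x i)
      · by_cases hc : i ∈ M.closure (((activeSet M ρ x ∩ N).erase i ∪ S : Finset α) : Set α)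
        · rw [if_neg (not_not.2 hc), mul_zero]
          exact zero_le
        · have hsel : Selected M θ σ C (activeSet M ρ x) i := by
            refine ⟨(mem_activeSet M).2 hx, l, hl, h1, h2, fun h => hc ?_⟩
            refine M.closure_subset_closure (Finset.coe_subset.2 ?_) h
            refine Finset.union_subset_union (fun j hj => ?_) le_rfl
            simp only [Finset.mem_inter, Finset.mem_filter, Finset.mem_erase] at hj ⊢
            exact ⟨hj.1.2.ne, hj.1.1, hj.2⟩
          rw [if_pos hx, if_pos hc, if_pos hsel, mul_one]
      · simp [hx]

theorem measurePreserving_activeSet_pi [NeZero m] (ρ : Fin m → Block k α) (L J T : ℕ) :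
    MeasurePreserving (fun (X : Fin L × Fin J → Fin T → α → ℝ≥0 × Coin m) p t =>
        activeSet M ρ (X p t))
      (Measure.pi fun _ => Measure.pi fun _ => Measure.pi (itemMeasure m D))
      (Measure.pi fun _ => Measure.pi fun _ => activeLaw M D ρ) := by
  have h0 : MeasurePreserving (activeSet M ρ) (Measure.pi (itemMeasure m D)) (activeLaw M D ρ) :=
    ⟨measurable_activeSet_right M ρ, rfl⟩
  have h1 : MeasurePreserving (fun (X : Fin T → α → ℝ≥0 × Coin m) t => activeSet M ρ (X t))
      (Measure.pi fun _ => Measure.pi (itemMeasure m D)) (Measure.pi fun _ => activeLaw M D ρ) :=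
    measurePreserving_pi (fun _ => Measure.pi (itemMeasure m D)) (fun _ => activeLaw M D ρ)
      fun _ => h0
  exact measurePreserving_pi (fun _ : Fin L × Fin J => Measure.pi fun _ : Fin T =>
    Measure.pi (itemMeasure m D)) (fun _ => Measure.pi fun _ => activeLaw M D ρ) fun _ => h1

theorem prob_compl_union_ge {Ω : Type*} [MeasurableSpace Ω] (μ : Measure Ω)
    [IsProbabilityMeasure μ] {A B : Set Ω} (hA : MeasurableSet A) (hB : MeasurableSet B) {a b : ℝ}
    (ha0 : 0 ≤ a) (hb0 : 0 ≤ b) (ha : μ A ≤ ENNReal.ofReal a) (hb : μ B ≤ ENNReal.ofReal b) :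
    ENNReal.ofReal (1 - (a + b)) ≤ μ (A ∪ B)ᶜ := by
  have h1 := prob_add_prob_compl (μ := μ) (hA.union hB)
  have h2 := (measure_union_le (μ := μ) A B).trans (add_le_add ha hb)
  rw [← ENNReal.ofReal_add ha0 hb0] at h2
  rw [ENNReal.ofReal_sub _ (by positivity), ENNReal.ofReal_one, tsub_le_iff_left, ← h1]
  gcongr

theorem measure_accurate_notDropped_ge [NeZero J] (ν : Measure (Finset α))
    [IsProbabilityMeasure ν] {θ δ : ℝ} (hδ : 0 ≤ δ) (i : α) :
    ENNReal.ofReal (1 - (L * J * (Fintype.card α * (2 * Real.exp (-(2 * δ ^ 2 * T)))) + L / J)) ≤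
      ((Measure.pi fun _ : Fin L => uniformMeasure (Fin J)).prod
        (Measure.pi fun _ : Fin L × Fin J => Measure.pi fun _ : Fin T => ν))
      ({p | ¬ ChainAccurate M ν θ δ p.1 p.2} ∪ {p | Dropped M θ p.1 p.2 i})ᶜ := by
  refine prob_compl_union_ge _ .of_discrete .of_discrete (by positivity) (by positivity) ?_ ?_
  · rw [Measure.prod_apply .of_discrete]
    refine (lintegral_mono fun σ => measure_not_chainAccurate_le ν hδ σ).trans ?_
    rw [lintegral_const, measure_univ, mul_one]
  · rw [Measure.prod_apply_symm .of_discrete]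
    refine (lintegral_mono fun C => measure_dropped_le θ C i).trans ?_
    rw [lintegral_const, measure_univ, mul_one]

theorem lintegral_selected_ge [NeZero m] [NeZero J] (hE : M.E = Set.univ) (hT : 0 < T)
    {θ δ δ' : ℝ} {ρ : Fin m → Block k α} (hρ : WellSpread M D δ' ρ) (hδ0 : 0 ≤ δ) (hδ : δ < θ)
    (hδ' : 0 ≤ δ') (hL : ((1 + δ') / 2 / (θ - δ)) ^ L * Fintype.card α < 1) {w : ℝ≥0 → ℝ≥0}
    (hw : Measurable w) (i : α) :
    ENNReal.ofReal (1 - (θ + δ)) * ENNReal.ofReal (1 - (L * J * (Fintype.card α *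
        (2 * Real.exp (-(2 * δ ^ 2 * T)))) + L / J)) * activeValue M D w ρ i ≤
      ∫⁻ σ, ∫⁻ X : Fin L × Fin J → Fin T → α → ℝ≥0 × Coin m, ∫⁻ x,
        Set.indicator {x | Selected M θ σ (fun p t => activeSet M ρ (X p t)) (activeSet M ρ x) i}
          (fun x => (w (x i).1 : ℝ≥0∞)) x ∂Measure.pi (itemMeasure m D)
        ∂(Measure.pi fun _ => Measure.pi fun _ => Measure.pi (itemMeasure m D))
        ∂(Measure.pi fun _ : Fin L => uniformMeasure (Fin J)) := by
  classical
  -- A loop is never active; for the other items, accuracy and not being dropped suffice.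
  by_cases hi : i ∈ M.closure ∅
  · have h0 : {x | Active M ρ i x} = ∅ := by
      ext x
      simp only [Set.mem_ofPred_eq, Set.mem_empty_iff_false, iff_false]
      exact fun h => passes_notMem_closure_empty M h.2 hi
    simp [activeValue, h0]
  set f : (Fin L → Fin J) → (Fin L × Fin J → Fin T → Finset α) → ℝ≥0∞ := fun σ C =>
    ∫⁻ x, Set.indicator {x | Selected M θ σ C (activeSet M ρ x) i}
        (fun x => (w (x i).1 : ℝ≥0∞)) x ∂Measure.pi (itemMeasure m D) with hf
  have hX : ∀ σ, ∫⁻ X : Fin L × Fin J → Fin T → α → ℝ≥0 × Coin m,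
      f σ (fun p t => activeSet M ρ (X p t))
        ∂(Measure.pi fun _ => Measure.pi fun _ => Measure.pi (itemMeasure m D)) =
      ∫⁻ C, f σ C ∂(Measure.pi fun _ => Measure.pi fun _ => activeLaw M D ρ) := fun σ =>
    (measurePreserving_activeSet_pi (M := M) (D := D) ρ L J T).lintegral_comp
      (f := f σ) .of_discrete
  change _ ≤ ∫⁻ σ, ∫⁻ X : Fin L × Fin J → Fin T → α → ℝ≥0 × Coin m,
      f σ (fun p t => activeSet M ρ (X p t))
        ∂(Measure.pi fun _ => Measure.pi fun _ => Measure.pi (itemMeasure m D))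
        ∂(Measure.pi fun _ : Fin L => uniformMeasure (Fin J))
  simp_rw [hX]
  rw [lintegral_lintegral (f := f) Measurable.of_discrete.aemeasurable]
  set G : Set ((Fin L → Fin J) × (Fin L × Fin J → Fin T → Finset α)) :=
    ({p | ¬ ChainAccurate M (activeLaw M D ρ) θ δ p.1 p.2} ∪ {p | Dropped M θ p.1 p.2 i})ᶜ with hG
  have hle : ∀ p, G.indicator (fun _ => ENNReal.ofReal (1 - (θ + δ)) * activeValue M D w ρ i) p ≤
      f p.1 p.2 := by
    intro p
    by_cases hp : p ∈ G
    · rw [Set.indicator_of_mem hp]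
      have hp' : ¬ (¬ ChainAccurate M (activeLaw M D ρ) θ δ p.1 p.2 ∨ Dropped M θ p.1 p.2 i) := hp
      rw [not_or, not_not] at hp'
      exact lintegral_selected_ge_of_accurate hE hT hρ hδ hδ' hL hw hp'.1 hi hp'.2
    · rw [Set.indicator_of_notMem hp]
      exact zero_le
  refine le_trans ?_ (lintegral_mono hle)
  rw [lintegral_indicator_const .of_discrete, mul_right_comm]
  gcongr
  exact measure_accurate_notDropped_ge (activeLaw M D ρ) hδ0 i

end Selection

/-! ### Averaging over the blocks. -/

section Selection

variable {α : Type*} [LinearOrder α] [Fintype α] {k m T L J : ℕ}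

/-- The expected value of the selected items, given the blocks of samples. -/
noncomputable def selectedValue (M : Matroid α) (D : α → Measure ℝ≥0) (θ : ℝ) (L J T : ℕ)
    (w : ℝ≥0 → ℝ≥0) (ρ : Fin m → Block k α) : ℝ≥0∞ :=
  ∑ i, ∫⁻ σ, ∫⁻ X : Fin L × Fin J → Fin T → α → ℝ≥0 × Coin m, ∫⁻ x,
    Set.indicator {x | Selected M θ σ (fun p t => activeSet M ρ (X p t)) (activeSet M ρ x) i}
      (fun x => (w (x i).1 : ℝ≥0∞)) x ∂Measure.pi (itemMeasure m D)
    ∂(Measure.pi fun _ => Measure.pi fun _ => Measure.pi (itemMeasure m D))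
    ∂(Measure.pi fun _ : Fin L => uniformMeasure (Fin J))

theorem selectedValue_mono {M : Matroid α} {D : α → Measure ℝ≥0} {θ : ℝ} {w w' : ℝ≥0 → ℝ≥0}
    (h : w ≤ w') (ρ : Fin m → Block k α) :
    selectedValue M D θ L J T w ρ ≤ selectedValue M D θ L J T w' ρ := by
  refine Finset.sum_le_sum fun i _ => ?_
  refine lintegral_mono fun σ => lintegral_mono fun X => lintegral_mono fun x => ?_
  exact Set.indicator_le_indicator (ENNReal.coe_le_coe.2 (h _))

variable {M : Matroid α} {D : α → Measure ℝ≥0} [∀ i, IsProbabilityMeasure (D i)]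

theorem measurable_activeValue [NeZero m] {w : ℝ≥0 → ℝ≥0} (hw : Measurable w) (i : α) :
    Measurable fun ρ : Fin m → Block k α => activeValue M D w ρ i := by
  refine Measurable.lintegral_prod_right' (f := fun p : (Fin m → Block k α) × (ℝ≥0 × Coin m) =>
    Set.indicator {x | Active M p.1 i x} (fun x => (w x.1 : ℝ≥0∞)) p.2) ?_
  exact (hw.comp (measurable_fst.comp measurable_snd)).coe_nnreal_ennreal.indicator
    (measurableSet_active_prod M i)

theorem activeValue_le_greedyValue [NeZero m] (hE : M.E = Set.univ) {w : ℝ≥0 → ℝ≥0}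
    (hw : Monotone w) (ρ : Fin m → Block k α) (i : α) :
    activeValue M D w ρ i ≤ 2⁻¹ * greedyValue M D w := by
  by_cases hi : i ∈ M.closure ∅
  · have h0 : {x | Active M ρ i x} = ∅ := by
      ext x
      simp only [Set.mem_ofPred_eq, Set.mem_empty_iff_false, iff_false]
      exact fun h => passes_notMem_closure_empty M h.2 hi
    simp [activeValue, h0]
  · refine (lintegral_active_le M ρ i (w := fun v => (w v : ℝ≥0∞))
      hw.measurable.coe_nnreal_ennreal).trans ?_
    gcongr
    exact lintegral_le_greedyValue hE hw hi

theorem greedyValue_le_lintegral_activeValue [NeZero k] [NeZero m] {w : ℝ≥0 → ℝ≥0}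
    (hw : Measurable w) :
    2⁻¹ * greedyValue M D w ≤
      ∫⁻ ρ, ∑ i, activeValue M D w ρ i ∂Measure.pi (fun _ : Fin m => blockMeasure k D) := by
  rw [lintegral_finsetSum _ fun i _ => measurable_activeValue hw i, greedyValue, Finset.mul_sum]
  exact Finset.sum_le_sum fun i _ => lintegral_greedy_le_active M i hw.coe_nnreal_ennreal

/-- Discarding an unlikely event for the blocks costs little. -/
theorem greedyValue_le_setLIntegral [NeZero k] [NeZero m] (hE : M.E = Set.univ)
    {w : ℝ≥0 → ℝ≥0} (hw : Monotone w) (hfin : greedyValue M D w < ⊤) {G : Set (Fin m → Block k α)}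
    (hG : MeasurableSet G) {p : ℝ} (hp0 : 0 ≤ p)
    (hp : Measure.pi (fun _ : Fin m => blockMeasure k D) Gᶜ ≤ ENNReal.ofReal p) :
    ENNReal.ofReal ((1 - Fintype.card α * p) / 2) * greedyValue M D w ≤
      ∫⁻ ρ in G, ∑ i, activeValue M D w ρ i ∂Measure.pi (fun _ : Fin m => blockMeasure k D) := by
  set μ := Measure.pi (fun _ : Fin m => blockMeasure k D)
  -- The active value of an item never exceeds half of the greedy value, since a single nonloop is
  -- an independent set. So the bad blocks cost at most `Fintype.card α * p / 2` of it, and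
  -- finiteness is needed only to subtract this.
  have h1 := greedyValue_le_lintegral_activeValue (k := k) (m := m) (M := M) (D := D) hw.measurable
  rw [← lintegral_add_compl _ hG] at h1
  have h2 : ∫⁻ ρ in Gᶜ, ∑ i, activeValue M D w ρ i ∂μ ≤
      ENNReal.ofReal (Fintype.card α * p / 2) * greedyValue M D w := by
    calc _ ≤ ∫⁻ _ in Gᶜ, ∑ _i : α, 2⁻¹ * greedyValue M D w ∂μ :=
          lintegral_mono fun ρ => Finset.sum_le_sum fun i _ => activeValue_le_greedyValue hE hw ρ i
      _ = (Fintype.card α * (2⁻¹ * greedyValue M D w)) * μ Gᶜ := by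
          rw [setLIntegral_const, Finset.sum_const, Finset.card_univ, nsmul_eq_mul]
      _ ≤ (Fintype.card α * (2⁻¹ * greedyValue M D w)) * ENNReal.ofReal p := by gcongr
      _ = _ := by
          rw [ENNReal.ofReal_div_of_pos two_pos, ENNReal.ofReal_mul (by positivity),
            ENNReal.ofReal_natCast, ENNReal.ofReal_ofNat, div_eq_mul_inv]
          ring
  have h3 : 2⁻¹ * greedyValue M D w ≤ ∫⁻ ρ in G, ∑ i, activeValue M D w ρ i ∂μ +
      ENNReal.ofReal (Fintype.card α * p / 2) * greedyValue M D w := h1.trans (by gcongr)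
  rw [sub_div, ENNReal.ofReal_sub _ (by positivity), ENNReal.sub_mul fun _ _ => hfin.ne,
    tsub_le_iff_right, ENNReal.ofReal_div_of_pos two_pos, ENNReal.ofReal_one, ENNReal.ofReal_ofNat,
    one_div]
  exact h3

/-- Expectations may be infinite, so the estimate is made for values truncated at `B` in the weights
only, and then `B` tends to infinity. The three factors are the losses by contention, by inaccurate
chains and drops, and by the coin together with bad blocks. -/
theorem greedyValue_le_lintegral_selectedValue [NeZero k] [NeZero m] [NeZero J]
    (hE : M.E = Set.univ) (hT : 0 < T) {θ δ δ' p : ℝ} (hδ0 : 0 ≤ δ) (hδ : δ < θ) (hδ' : 0 ≤ δ')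
    (hL : ((1 + δ') / 2 / (θ - δ)) ^ L * Fintype.card α < 1) (hp0 : 0 ≤ p)
    (hp : Measure.pi (fun _ : Fin m => blockMeasure k D) {ρ | ¬ WellSpread M D δ' ρ} ≤
      ENNReal.ofReal p) :
    ENNReal.ofReal (1 - (θ + δ)) * ENNReal.ofReal (1 - (L * J * (Fintype.card α *
        (2 * Real.exp (-(2 * δ ^ 2 * T)))) + L / J)) *
        ENNReal.ofReal ((1 - Fintype.card α * p) / 2) * greedyValue M D id ≤
      ∫⁻ ρ, selectedValue M D θ L J T id ρ ∂Measure.pi (fun _ : Fin m => blockMeasure k D) := by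
  set c := ENNReal.ofReal (1 - (θ + δ)) * ENNReal.ofReal (1 - (L * J * (Fintype.card α *
        (2 * Real.exp (-(2 * δ ^ 2 * T)))) + L / J)) with hc
  have hctop : c ≠ ⊤ := ENNReal.mul_ne_top (by simp) (by simp)
  refine (mul_le_mul_right iSup_greedyValue_min _).trans ?_
  rw [ENNReal.mul_iSup]
  refine iSup_le fun B => ?_
  have hmono : Monotone fun v : ℝ≥0 => min v B := fun a b h => min_le_min_right _ h
  rw [mul_assoc]
  calc _ ≤ c * ∫⁻ ρ in {ρ | WellSpread M D δ' ρ}, ∑ i, activeValue M D (fun v => min v B) ρ i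
          ∂Measure.pi (fun _ : Fin m => blockMeasure k D) := by
        gcongr
        exact greedyValue_le_setLIntegral hE hmono (greedyValue_min_lt_top _)
          (measurableSet_wellSpread M δ') hp0 hp
    _ = ∫⁻ ρ in {ρ | WellSpread M D δ' ρ}, c * ∑ i, activeValue M D (fun v => min v B) ρ i
          ∂Measure.pi (fun _ : Fin m => blockMeasure k D) :=
        (lintegral_const_mul' _ _ hctop).symm
    _ ≤ ∫⁻ ρ in {ρ | WellSpread M D δ' ρ}, selectedValue M D θ L J T id ρ
          ∂Measure.pi (fun _ : Fin m => blockMeasure k D) := by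
        refine setLIntegral_mono' (measurableSet_wellSpread M δ') fun ρ hρ => ?_
        refine le_trans ?_ (selectedValue_mono (w := fun v => min v B)
          (fun v => min_le_left _ _) ρ)
        rw [Finset.mul_sum]
        exact Finset.sum_le_sum fun i _ =>
          lintegral_selected_ge hE hT hρ hδ0 hδ hδ' hL hmono.measurable i
    _ ≤ _ := setLIntegral_le_lintegral _ _

end Selection

/-! ### Rearranging independent inputs and the order of integration. -/

section Reshuffle

theorem measurePreserving_prodProdProdComm {A B C E : Type*} [MeasurableSpace A]
    [MeasurableSpace B] [MeasurableSpace C] [MeasurableSpace E] (a : Measure A) (b : Measure B)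
    (c : Measure C) (e : Measure E) [SFinite a] [SFinite b] [SFinite c] [SFinite e] :
    MeasurePreserving (fun x : (A × B) × (C × E) => ((x.1.1, x.2.1), (x.1.2, x.2.2)))
      ((a.prod b).prod (c.prod e)) ((a.prod c).prod (b.prod e)) := by
  have h1 : MeasurePreserving (MeasurableEquiv.prodAssoc (α := A) (β := B) (γ := C × E))
      ((a.prod b).prod (c.prod e)) (a.prod (b.prod (c.prod e))) :=
    measurePreserving_prodAssoc _ _ _
  have h2 : MeasurePreserving (fun x : B × (C × E) => (x.2.1, (x.1, x.2.2)))
      (b.prod (c.prod e)) (c.prod (b.prod e)) := by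
    have g1 := (measurePreserving_prodAssoc b c e).symm
    have g2 := (Measure.measurePreserving_swap (μ := b) (ν := c)).prod (MeasurePreserving.id e)
    exact ((measurePreserving_prodAssoc c b e).comp g2).comp g1
  have h3 := (MeasurePreserving.id a).prod h2
  have h4 := (measurePreserving_prodAssoc a c (b.prod e)).symm
  exact (h4.comp h3).comp h1

/-- Pairing up the coordinates of two independent families. -/
theorem measurePreserving_zip {ι X Y : Type*} [Fintype ι] [MeasurableSpace X] [MeasurableSpace Y]
    (μ : ι → Measure X) (ν : ι → Measure Y) [∀ i, IsProbabilityMeasure (μ i)]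
    [∀ i, IsProbabilityMeasure (ν i)] :
    MeasurePreserving (fun (p : (ι → X) × (ι → Y)) i => (p.1 i, p.2 i))
      ((Measure.pi μ).prod (Measure.pi ν)) (Measure.pi fun i => (μ i).prod (ν i)) :=
  (measurePreserving_arrowProdEquivProdArrow X Y ι μ ν).symm

/-- Splitting a family of independent samples into two families of groups of samples. -/
theorem measurePreserving_split {ι κ₁ κ₂ κ₃ κ₄ X : Type*} [Fintype ι] [Fintype κ₁] [Fintype κ₂]
    [Fintype κ₃] [Fintype κ₄] [MeasurableSpace X] (e : ι ≃ (κ₁ × κ₂) ⊕ (κ₃ × κ₄)) (μ : Measure X)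
    [IsProbabilityMeasure μ] :
    MeasurePreserving (fun s : ι → X => ((fun a b => s (e.symm (Sum.inl (a, b)))),
        fun a b => s (e.symm (Sum.inr (a, b)))))
      (Measure.pi fun _ => μ)
      ((Measure.pi fun _ : κ₁ => Measure.pi fun _ : κ₂ => μ).prod
        (Measure.pi fun _ : κ₃ => Measure.pi fun _ : κ₄ => μ)) := by
  have h1 := (measurePreserving_piCongrLeft (fun _ : ι => μ) e.symm).symm
  have h2 := measurePreserving_sumPiEquivProdPi (fun _ : (κ₁ × κ₂) ⊕ (κ₃ × κ₄) => μ)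
  have h3 := (measurePreserving_curry (fun (_ : κ₁) (_ : κ₂) => μ)).prod
    (measurePreserving_curry (fun (_ : κ₃) (_ : κ₄) => μ))
  exact (h3.comp h2).comp h1

theorem lintegral_prod_reorder {A B C E : Type*} [MeasurableSpace A]
    [MeasurableSpace B] [MeasurableSpace C] [MeasurableSpace E] (a : Measure A) (b : Measure B)
    (c : Measure C) (e : Measure E) [SFinite a] [SFinite b] [SFinite c] [SFinite e]
    {f : (A × B) × (C × E) → ℝ≥0∞} (hf : Measurable f) :
    ∫⁻ z, f z ∂((a.prod b).prod (c.prod e)) =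
      ∫⁻ x, ∫⁻ w, ∫⁻ y, ∫⁻ z, f ((x, y), (z, w)) ∂c ∂b ∂e ∂a := by
  rw [lintegral_prod _ hf.aemeasurable, lintegral_prod _ (hf.lintegral_prod_right').aemeasurable]
  refine lintegral_congr fun x => ?_
  have hfx : Measurable fun q : B × C × E => f ((x, q.1), q.2) := hf.comp (by fun_prop)
  calc _ = ∫⁻ y, ∫⁻ w, ∫⁻ z, f ((x, y), (z, w)) ∂c ∂e ∂b :=
        lintegral_congr fun y => lintegral_prod_symm' _
          (hfx.comp (measurable_const.prodMk measurable_id))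
    _ = _ := by
        refine lintegral_lintegral_swap (Measurable.aemeasurable ?_)
        exact Measurable.lintegral_prod_right' (f := fun q : (B × E) × C =>
          f ((x, q.1.1), (q.2, q.1.2))) (hf.comp (by fun_prop))

theorem measurable_lintegral_reorder {A B C E : Type*} [MeasurableSpace A]
    [MeasurableSpace B] [MeasurableSpace C] [MeasurableSpace E] (b : Measure B)
    (c : Measure C) (e : Measure E) [SFinite b] [SFinite c] [SFinite e]
    {f : (A × B) × (C × E) → ℝ≥0∞} (hf : Measurable f) :
    Measurable fun x => ∫⁻ w, ∫⁻ y, ∫⁻ z, f ((x, y), (z, w)) ∂c ∂b ∂e := by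
  refine Measurable.lintegral_prod_right' (f := fun q : A × E =>
    ∫⁻ y, ∫⁻ z, f ((q.1, y), (z, q.2)) ∂c ∂b) ?_
  refine Measurable.lintegral_prod_right' (f := fun q : (A × E) × B =>
    ∫⁻ z, f ((q.1.1, q.2), (z, q.1.2)) ∂c) ?_
  exact Measurable.lintegral_prod_right' (f := fun q : ((A × E) × B) × C =>
    f ((q.1.1.1, q.1.2), (q.2, q.1.1.2))) (hf.comp (by fun_prop))

end Reshuffle

/-! ### The algorithm and its expected value. -/

section Algorithm

variable {n k m L J T K : ℕ}

/-- The internal randomness: the groups in the blocks of samples, the coins of the samples of the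
rounds, the coins of the items, and the stopping times of the layers. -/
abbrev MatroidSeed (n k m L J T : ℕ) :=
  ((Fin m → Fin n → Fin k) × (Fin L × Fin J → Fin T → Fin n → Coin m)) ×
    ((Fin n → Coin m) × (Fin L → Fin J))

/-- The distribution of the internal randomness. -/
noncomputable def seedMeasure (n k m L J T : ℕ) : Measure (MatroidSeed n k m L J T) :=
  ((Measure.pi fun _ => Measure.pi fun _ => uniformMeasure (Fin k)).prod
    (Measure.pi fun _ => Measure.pi fun _ => Measure.pi fun _ => uniformMeasure (Coin m))).prod
    ((Measure.pi fun _ => uniformMeasure (Coin m)).prod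
      (Measure.pi fun _ => uniformMeasure (Fin J)))

instance [NeZero k] [NeZero m] [NeZero J] : IsProbabilityMeasure (seedMeasure n k m L J T) := by
  have h1 : IsProbabilityMeasure ((Measure.pi fun _ : Fin m => Measure.pi fun _ : Fin n =>
      uniformMeasure (Fin k)).prod (Measure.pi fun _ : Fin L × Fin J => Measure.pi fun _ : Fin T =>
      Measure.pi fun _ : Fin n => uniformMeasure (Coin m))) := inferInstance
  have h2 : IsProbabilityMeasure ((Measure.pi fun _ : Fin n => uniformMeasure (Coin m)).prod
      (Measure.pi fun _ : Fin L => uniformMeasure (Fin J))) := inferInstance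
  exact Measure.prod.instIsProbabilityMeasure _ _

/-- Arranging the input of the algorithm into blocks, rounds, items and stopping times. -/
def arrange (e : Fin K ≃ (Fin m × Fin k) ⊕ ((Fin L × Fin J) × Fin T))
    (y : MatroidSeed n k m L J T × (Fin K → Fin n → ℝ≥0) × (Fin n → ℝ≥0)) :
    ((Fin m → Block k (Fin n)) × (Fin L × Fin J → Fin T → Fin n → ℝ≥0 × Coin m)) ×
      ((Fin n → ℝ≥0 × Coin m) × (Fin L → Fin J)) :=
  ((fun a => (fun g => y.2.1 (e.symm (Sum.inl (a, g))), y.1.1.1 a),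
    fun p t i => (y.2.1 (e.symm (Sum.inr (p, t))) i, y.1.1.2 p t i)),
    (fun i => (y.2.2 i, y.1.2.1 i), y.1.2.2))

theorem measurePreserving_arrange [NeZero k] [NeZero m] [NeZero J]
    (e : Fin K ≃ (Fin m × Fin k) ⊕ ((Fin L × Fin J) × Fin T)) (D : Fin n → Measure ℝ≥0)
    [∀ i, IsProbabilityMeasure (D i)] :
    MeasurePreserving (arrange e)
      ((seedMeasure n k m L J T).prod
        ((Measure.pi fun _ : Fin K => Measure.pi D).prod (Measure.pi D)))
      (((Measure.pi fun _ : Fin m => blockMeasure k D).prod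
        (Measure.pi fun _ => Measure.pi fun _ => Measure.pi (itemMeasure m D))).prod
        ((Measure.pi (itemMeasure m D)).prod (Measure.pi fun _ => uniformMeasure (Fin J)))) := by
  have h1 := Measure.measurePreserving_swap (μ := seedMeasure n k m L J T)
    (ν := (Measure.pi fun _ : Fin K => Measure.pi D).prod (Measure.pi D))
  have h2 := ((measurePreserving_split e (Measure.pi D)).prod
    (MeasurePreserving.id (Measure.pi D))).prod (MeasurePreserving.id (seedMeasure n k m L J T))
  have h3 := measurePreserving_prodProdProdComm
    ((Measure.pi fun _ : Fin m => Measure.pi fun _ : Fin k => Measure.pi D).prod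
      (Measure.pi fun _ : Fin L × Fin J => Measure.pi fun _ : Fin T => Measure.pi D))
    (Measure.pi D)
    ((Measure.pi fun _ : Fin m => Measure.pi fun _ : Fin n => uniformMeasure (Fin k)).prod
      (Measure.pi fun _ : Fin L × Fin J => Measure.pi fun _ : Fin T => Measure.pi fun _ : Fin n =>
        uniformMeasure (Coin m)))
    ((Measure.pi fun _ : Fin n => uniformMeasure (Coin m)).prod
      (Measure.pi fun _ : Fin L => uniformMeasure (Fin J)))
  have hx : MeasurePreserving (fun (p : (Fin n → ℝ≥0) × (Fin n → Coin m)) i => (p.1 i, p.2 i))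
      ((Measure.pi D).prod (Measure.pi fun _ => uniformMeasure (Coin m)))
      (Measure.pi (itemMeasure m D)) :=
    measurePreserving_zip D fun _ => uniformMeasure (Coin m)
  have hX1 := (measurePreserving_pi (fun _ : Fin T => (Measure.pi D).prod
    (Measure.pi fun _ : Fin n => uniformMeasure (Coin m)))
    (fun _ : Fin T => Measure.pi (itemMeasure m D)) fun _ => hx).comp
    (measurePreserving_zip (fun _ : Fin T => Measure.pi D)
      fun _ : Fin T => Measure.pi fun _ : Fin n => uniformMeasure (Coin m))
  have hX := (measurePreserving_pi (fun _ : Fin L × Fin J =>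
    (Measure.pi fun _ : Fin T => Measure.pi D).prod
    (Measure.pi fun _ : Fin T => Measure.pi fun _ : Fin n => uniformMeasure (Coin m)))
    (fun _ : Fin L × Fin J => Measure.pi fun _ : Fin T => Measure.pi (itemMeasure m D))
      fun _ => hX1).comp
    (measurePreserving_zip (fun _ : Fin L × Fin J => Measure.pi fun _ : Fin T => Measure.pi D)
      fun _ : Fin L × Fin J => Measure.pi fun _ : Fin T =>
        Measure.pi fun _ : Fin n => uniformMeasure (Coin m))
  have hρ := measurePreserving_zip (fun _ : Fin m => Measure.pi fun _ : Fin k => Measure.pi D)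
    (fun _ : Fin m => Measure.pi fun _ : Fin n => uniformMeasure (Fin k))
  have h4 := (measurePreserving_prodProdProdComm
    (Measure.pi fun _ : Fin m => Measure.pi fun _ : Fin k => Measure.pi D)
    (Measure.pi fun _ : Fin L × Fin J => Measure.pi fun _ : Fin T => Measure.pi D)
    (Measure.pi fun _ : Fin m => Measure.pi fun _ : Fin n => uniformMeasure (Fin k))
    (Measure.pi fun _ : Fin L × Fin J => Measure.pi fun _ : Fin T => Measure.pi fun _ : Fin n =>
        uniformMeasure (Coin m)))
  have h5 := (measurePreserving_prodAssoc (Measure.pi D)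
    (Measure.pi fun _ : Fin n => uniformMeasure (Coin m))
    (Measure.pi fun _ : Fin L => uniformMeasure (Fin J))).symm
  have h6 := ((hρ.prod hX).comp h4).prod ((hx.prod (MeasurePreserving.id
    (Measure.pi fun _ : Fin L => uniformMeasure (Fin J)))).comp h5)
  exact ((h6.comp h3).comp h2).comp h1

/-- The set of the active items, the outcomes of the rounds, and the stopping times. -/
noncomputable def outcome (M : Matroid (Fin n))
    (z : ((Fin m → Block k (Fin n)) × (Fin L × Fin J → Fin T → Fin n → ℝ≥0 × Coin m)) ×
      ((Fin n → ℝ≥0 × Coin m) × (Fin L → Fin J))) :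
    (Fin L → Fin J) × (Fin L × Fin J → Fin T → Finset (Fin n)) × Finset (Fin n) :=
  (z.2.2, fun p t => activeSet M z.1.1 (z.1.2 p t), activeSet M z.1.1 z.2.1)

theorem measurable_outcome (M : Matroid (Fin n)) :
    Measurable (outcome M (k := k) (m := m) (L := L) (J := J) (T := T)) := by
  refine (measurable_snd.comp measurable_snd).prodMk (Measurable.prodMk ?_ ?_)
  · refine measurable_pi_lambda _ fun p => measurable_pi_lambda _ fun t => ?_
    exact (measurable_activeSet M).comp (f := fun z : ((Fin m → Block k (Fin n)) ×
      (Fin L × Fin J → Fin T → Fin n → ℝ≥0 × Coin m)) ×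
      ((Fin n → ℝ≥0 × Coin m) × (Fin L → Fin J)) => (z.1.1, z.1.2 p t)) (by fun_prop)
  · exact (measurable_activeSet M).comp (f := fun z : ((Fin m → Block k (Fin n)) ×
      (Fin L × Fin J → Fin T → Fin n → ℝ≥0 × Coin m)) ×
      ((Fin n → ℝ≥0 × Coin m) × (Fin L → Fin J)) => (z.1.1, z.2.1)) (by fun_prop)

open scoped Classical in
/-- The algorithm which takes the selected items. -/
noncomputable def selectionAlgorithm [NeZero k] [NeZero m] [NeZero J] (M : Matroid (Fin n))
    (hE : M.E = Set.univ) (θ : ℝ) (e : Fin K ≃ (Fin m × Fin k) ⊕ ((Fin L × Fin J) × Fin T)) :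
    SampleOnlineAlgorithm n K M.indepFamily where
  Seed := MatroidSeed n k m L J T
  law := seedMeasure n k m L J T
  accept i r s v :=
    let q := outcome M (arrange e (r, s, v))
    decide (Selected M θ q.1 q.2.1 q.2.2 i)
  measurable_accept i := by
    have h : Measurable (arrange (n := n) e) := by
      unfold arrange
      fun_prop
    -- Selection depends on the input only through `outcome`, which lives in a discrete space.
    exact (Measurable.of_discrete (f := fun q : (Fin L → Fin J) ×
      (Fin L × Fin J → Fin T → Finset (Fin n)) × Finset (Fin n) =>
      decide (Selected M θ q.1 q.2.1 q.2.2 i))).comp ((measurable_outcome M).comp h)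
  online i r s v w h := by
    refine decide_eq_decide.2 (selected_congr fun j hj => ?_)
    -- The chain uses only samples and seed, and the activity of `j` uses only the value of `j`
    -- besides these.
    simp only [outcome, arrange, mem_activeSet, h j hj]
  feasible r s v := by
    simp only [decide_eq_true_eq]
    exact indep_selected hE

theorem expectedValue_selectionAlgorithm [NeZero k] [NeZero m] [NeZero J] (M : Matroid (Fin n))
    (hE : M.E = Set.univ) (θ : ℝ) (e : Fin K ≃ (Fin m × Fin k) ⊕ ((Fin L × Fin J) × Fin T))
    (D : Fin n → Measure ℝ≥0) [∀ i, IsProbabilityMeasure (D i)] :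
    (selectionAlgorithm M hE θ e).expectedValue D =
      ∫⁻ ρ, selectedValue M D θ L J T id ρ ∂Measure.pi (fun _ : Fin m => blockMeasure k D) := by
  classical
  let f : Fin n → (((Fin m → Block k (Fin n)) ×
      (Fin L × Fin J → Fin T → Fin n → ℝ≥0 × Coin m)) ×
      ((Fin n → ℝ≥0 × Coin m) × (Fin L → Fin J))) → ℝ≥0∞ := fun i z =>
    Set.indicator {z | Selected M θ (outcome M z).1 (outcome M z).2.1 (outcome M z).2.2 i}
      (fun z => ((z.2.1 i).1 : ℝ≥0∞)) z
  have hf : ∀ i, Measurable (f i) := fun i => by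
    refine Measurable.indicator (by fun_prop) ?_
    exact measurable_outcome M (MeasurableSet.of_discrete
      (s := {q : (Fin L → Fin J) × (Fin L × Fin J → Fin T → Finset (Fin n)) × Finset (Fin n) |
        Selected M θ q.1 q.2.1 q.2.2 i}))
  have h1 : (selectionAlgorithm M hE θ e).expectedValue D =
      ∫⁻ z, ∑ i, f i z ∂(((Measure.pi fun _ : Fin m => blockMeasure k D).prod
        (Measure.pi fun _ => Measure.pi fun _ => Measure.pi (itemMeasure m D))).prod
        ((Measure.pi (itemMeasure m D)).prod (Measure.pi fun _ => uniformMeasure (Fin J)))) := by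
    rw [← (measurePreserving_arrange e D).lintegral_comp (Finset.measurable_sum _ fun i _ => hf i)]
    refine lintegral_congr fun y => ?_
    rw [SampleOnlineAlgorithm.output, Finset.sum_filter]
    refine Finset.sum_congr rfl fun i _ => ?_
    simp only [selectionAlgorithm, decide_eq_true_eq, f, Set.indicator_apply, Set.mem_ofPred_eq,
      arrange]
  rw [h1, lintegral_finsetSum _ fun i _ => hf i]
  have h2 : ∀ i, ∫⁻ z, f i z ∂(((Measure.pi fun _ : Fin m => blockMeasure k D).prod
        (Measure.pi fun _ => Measure.pi fun _ => Measure.pi (itemMeasure m D))).prod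
        ((Measure.pi (itemMeasure m D)).prod (Measure.pi fun _ => uniformMeasure (Fin J)))) = _ :=
    fun i => lintegral_prod_reorder _ _ _ _ (hf i)
  rw [Finset.sum_congr rfl fun i _ => h2 i,
    ← lintegral_finsetSum _ fun i _ => measurable_lintegral_reorder _ _ _ (hf i)]
  rfl

end Algorithm

/-! ### Competitiveness, and the case of at most one item. -/

section Competitive

variable {n k m L J T K : ℕ}

theorem isCompetitive_selectionAlgorithm [NeZero k] [NeZero m] [NeZero J] (M : Matroid (Fin n))
    (hE : M.E = Set.univ) (e : Fin K ≃ (Fin m × Fin k) ⊕ ((Fin L × Fin J) × Fin T)) {δ ε p : ℝ}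
    (hδ0 : 0 < δ) (hδ1 : δ ≤ 1 / 40) (hδε : 9 * δ ≤ 4 * ε) (hT : 0 < T)
    (hL : ((1 + δ) / 2 / (1 / 2 + 2 * δ - δ)) ^ L * n < 1)
    (hA : L * J * (n * (2 * Real.exp (-(2 * δ ^ 2 * T)))) ≤ δ) (hJ : (L / J : ℝ) ≤ δ)
    (hp0 : 0 ≤ p) (hp1 : n * p ≤ δ)
    (hp : ∀ D : Fin n → Measure ℝ≥0, (∀ i, IsProbabilityMeasure (D i)) →
      Measure.pi (fun _ : Fin m => blockMeasure k D) {ρ | ¬ WellSpread M D δ ρ} ≤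
        ENNReal.ofReal p) :
    (selectionAlgorithm M hE (1 / 2 + 2 * δ) e).IsCompetitive (1 / 4 - ε) := by
  intro D hD
  rw [expectedValue_selectionAlgorithm]
  refine le_trans ?_ (greedyValue_le_lintegral_selectedValue hE hT hδ0.le (by linarith) hδ0.le
    (by rwa [Fintype.card_fin]) hp0 (hp D hD))
  rw [Fintype.card_fin]
  refine mul_le_mul' ?_ (prophetValue_le_greedyValue hE D)
  have h1 : (1 : ℝ) - 2 * δ ≤ 1 - (L * J * (n * (2 * Real.exp (-(2 * δ ^ 2 * T)))) + L / J) := by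
    linarith
  have h2 : (1 - δ) / 2 ≤ (1 - n * p) / 2 := by linarith
  have h3 : (1 / 2 - 3 * δ : ℝ) = 1 - (1 / 2 + 2 * δ + δ) := by ring
  calc ENNReal.ofReal (1 / 4 - ε)
      ≤ ENNReal.ofReal ((1 / 2 - 3 * δ) * (1 - 2 * δ) * ((1 - δ) / 2)) := by
        refine ENNReal.ofReal_le_ofReal ?_
        -- To first order the product is `1 / 4 - 9 * δ / 4`, whence `9 * δ ≤ 4 * ε`.
        nlinarith [mul_nonneg hδ0.le hδ0.le, mul_nonneg hδ0.le (sub_nonneg.2 hδ1)]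
    _ = ENNReal.ofReal (1 / 2 - 3 * δ) * ENNReal.ofReal (1 - 2 * δ) *
        ENNReal.ofReal ((1 - δ) / 2) := by
        rw [ENNReal.ofReal_mul (by nlinarith), ENNReal.ofReal_mul (by linarith)]
    _ ≤ _ := by rw [← h3]; gcongr

/-- The algorithm which takes all items if they form an independent set, and none otherwise. -/
noncomputable def allOrNothing (k : ℕ) (M : Matroid (Fin n)) :
    SampleOnlineAlgorithm n k M.indepFamily := by
  classical
  exact
  { Seed := Unit
    law := Measure.dirac ()
    accept := fun _ _ _ _ => decide (M.Indep Set.univ)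
    measurable_accept := fun _ => measurable_const
    online := fun _ _ _ _ _ _ => rfl
    feasible := fun _ _ _ => by
      by_cases h : M.Indep Set.univ <;> simp [h, Matroid.indepFamily] }

theorem isCompetitive_allOrNothing (hn : n < 2) (M : Matroid (Fin n)) {c : ℝ} (hc : c ≤ 1) :
    (allOrNothing k M).IsCompetitive c := by
  classical
  intro D hD
  have hmp : MeasurePreserving (fun x : Unit × (Fin k → Fin n → ℝ≥0) × (Fin n → ℝ≥0) => x.2.2)
      ((Measure.dirac ()).prod ((Measure.pi fun _ : Fin k => Measure.pi D).prod (Measure.pi D)))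
      (Measure.pi D) := measurePreserving_snd.comp measurePreserving_snd
  have hc1 : ENNReal.ofReal c ≤ 1 := by simpa using ENNReal.ofReal_le_ofReal hc
  refine (mul_le_of_le_one_left' hc1).trans ?_
  by_cases h : M.Indep Set.univ
  · have h1 : (allOrNothing k M).expectedValue D = ∫⁻ v, ∑ i, (v i : ℝ≥0∞) ∂Measure.pi D := by
      rw [← hmp.lintegral_comp (by fun_prop)]
      refine lintegral_congr fun x => ?_
      simp [SampleOnlineAlgorithm.output, allOrNothing, h]
    rw [h1]
    refine lintegral_mono fun v => iSup₂_le fun S _ => ?_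
    exact Finset.sum_le_sum_of_subset (Finset.subset_univ S)
  · have h1 : prophetValue M.indepFamily D ≤ 0 := by
      rw [← lintegral_zero (μ := Measure.pi D)]
      refine lintegral_mono fun v => iSup₂_le fun S hS => ?_
      have : S = ∅ := by
        by_contra hne
        obtain ⟨i, hi⟩ := Finset.nonempty_iff_ne_empty.2 hne
        have huniv : (S : Set (Fin n)) = Set.univ := Set.eq_univ_of_forall fun j => by
          have : j = i := by omega
          exact this ▸ Finset.mem_coe.2 hi
        exact h (huniv ▸ hS)
      simp [this]
    exact h1.trans zero_le

end Competitive

/-! ### Choice of the parameters. -/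

section Parameters

/-- A block has mean mass about `k / (k - 1)` per unit of rank, so `k ≥ 4 / δ` leaves room below `1
+ δ`, and a small `η = k * lam` makes the Chernoff factor less than 1. The value of `b` turns the
moment condition into an equality. -/
theorem exists_group_size {δ : ℝ} (hδ0 : 0 < δ) (hδ1 : δ ≤ 1 / 40) :
    ∃ (k : ℕ) (lam b : ℝ), 0 < k ∧ 0 ≤ lam ∧ 0 < b ∧ b ≤ 1 ∧
      Real.exp (k * lam) / k + (1 - 1 / k) * b ≤ 1 ∧ Real.exp (-(lam * (1 + δ))) * b⁻¹ < 1 := by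
  obtain ⟨k, hk⟩ := exists_nat_ge (4 / δ)
  set η := δ / 4 with hη
  have hk1 : (160 : ℝ) ≤ k := le_trans (by rw [le_div_iff₀ hδ0]; linarith) hk
  have hkδ : 4 ≤ k * δ := by rwa [div_le_iff₀ hδ0] at hk
  have hk0 : (0 : ℝ) < k := by linarith
  have he1 : 1 ≤ Real.exp η := Real.one_le_exp (by positivity)
  have he2 : Real.exp η ≤ 1 + η + η ^ 2 := by
    have := Real.abs_exp_sub_one_sub_id_le (x := η) (by rw [abs_le]; constructor <;> linarith)
    linarith [(abs_le.1 this).2]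
  have hη1 : η ≤ 1 / 160 := by linarith
  have hη0 : 0 < η := by positivity
  have he3 : Real.exp η ≤ 2 := by nlinarith
  have hb0 : 0 < (k - Real.exp η) / (k - 1) := div_pos (by linarith) (by linarith)
  refine ⟨k, η / k, (k - Real.exp η) / (k - 1), by exact_mod_cast hk0, by positivity, hb0,
    (div_le_one (by linarith)).2 (by linarith), le_of_eq ?_, ?_⟩
  · have h1 : (k : ℝ) - 1 ≠ 0 := by linarith
    rw [mul_div_cancel₀ _ hk0.ne']
    field_simp
    ring
  · rw [Real.exp_neg, ← mul_inv]
    refine inv_lt_one_of_one_lt₀ ?_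
    have h1 : 1 + η / k * (1 + δ) ≤ Real.exp (η / k * (1 + δ)) := by
      linarith [Real.add_one_le_exp (η / k * (1 + δ))]
    refine lt_of_lt_of_le ?_ (mul_le_mul_of_nonneg_right h1 hb0.le)
    have h2 : (1 + η / k * (1 + δ)) * ((k - Real.exp η) / (k - 1)) =
        ((k + η * (1 + δ)) * (k - Real.exp η)) / (k * (k - 1)) := by
      field_simp
    rw [h2, one_lt_div (mul_pos hk0 (by linarith))]
    have h3 : (k + η * (1 + δ)) * (k - (1 + η + η ^ 2)) ≤ (k + η * (1 + δ)) * (k - Real.exp η) :=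
      mul_le_mul_of_nonneg_left (by linarith) (by positivity)
    refine lt_of_lt_of_le ?_ h3
    have h4 : (1 + δ) * (1 + η + η ^ 2) < 3 := by nlinarith
    have h5 : (3 : ℝ) ≤ k * (δ - η) := by rw [hη]; linarith
    nlinarith [mul_pos hη0 (sub_pos.2 (h4.trans_le h5))]

/-- For `n ≥ 2` the constant is absorbed by `C ≤ 2 ^ a ≤ n ^ a`. The rounding term is absorbed by `1
/ Real.log 2`. -/
theorem exists_log_le_exp (C : ℝ) (p : ℕ) {s : ℝ} (hs : 0 < s) :
    ∃ (B : ℝ) (t : ℕ → ℕ), 0 ≤ B ∧ ∀ n : ℕ, 2 ≤ n → 0 < t n ∧ (t n : ℝ) ≤ B * Real.log n ∧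
      C * (n : ℝ) ^ p ≤ Real.exp (s * t n) := by
  obtain ⟨a, ha⟩ := pow_unbounded_of_one_lt C (one_lt_two (α := ℝ))
  have hl2 : 0 < Real.log 2 := Real.log_pos one_lt_two
  refine ⟨(a + p) / s + 1 / Real.log 2, fun n => ⌊(a + p) / s * Real.log n⌋₊ + 1, by positivity,
    fun n hn => ?_⟩
  have hn' : (2 : ℝ) ≤ n := by exact_mod_cast hn
  have hn0 : (0 : ℝ) < n := by linarith
  have hln : Real.log 2 ≤ Real.log n := Real.log_le_log two_pos hn'
  refine ⟨Nat.succ_pos _, ?_, ?_⟩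
  · push_cast
    have h1 := Nat.floor_le (a := (a + p) / s * Real.log n) (by positivity)
    have h2 : 1 ≤ 1 / Real.log 2 * Real.log n := by
      rw [one_div_mul_eq_div, one_le_div hl2]; exact hln
    linarith
  · have h1 : C * (n : ℝ) ^ p ≤ (n : ℝ) ^ (a + p) := by
      rw [pow_add]
      gcongr
      exact ha.le.trans (by gcongr)
    refine h1.trans ?_
    rw [← Real.exp_log hn0, ← Real.exp_nat_mul]
    refine Real.exp_le_exp.2 ?_
    have h2 := (Nat.lt_floor_add_one ((a + p) / s * Real.log n)).le
    calc ((a + p : ℕ) : ℝ) * Real.log n = s * ((a + p) / s * Real.log n) := by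
          push_cast; field_simp
      _ ≤ _ := by
          push_cast
          gcongr

theorem one_add_pow_sub_one_le {q δ : ℝ} {n : ℕ} (hq : 0 ≤ q) (hδ : δ ≤ 1) (hn : 1 ≤ n)
    (h : 2 * (n : ℝ) ^ 2 * q ≤ δ) : n * ((1 + q) ^ n - 1) ≤ δ := by
  have hn' : (1 : ℝ) ≤ n := by exact_mod_cast hn
  have hnq : n * q ≤ 1 := by
    have : n * q ≤ 2 * (n : ℝ) ^ 2 * q := by
      gcongr
      nlinarith
    linarith
  have h1 : (1 + q) ^ n ≤ Real.exp (n * q) := by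
    rw [Real.exp_nat_mul]
    gcongr
    linarith [Real.add_one_le_exp q]
  have h2 : Real.exp (n * q) ≤ 1 + 2 * (n * q) := by
    have h3 := Real.abs_exp_sub_one_le (x := n * q) (by rwa [abs_of_nonneg (by positivity)])
    rw [abs_of_nonneg (a := n * q) (by positivity)] at h3
    linarith [(abs_le.1 h3).2]
  calc _ ≤ n * (2 * (n * q)) := by gcongr; linarith
    _ = 2 * (n : ℝ) ^ 2 * q := by ring
    _ ≤ δ := h

end Parameters

/-! ### Assembling the parameters. -/

theorem theorem1 (ε : ℝ) (hε : 0 < ε) :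
    ∃ (C : ℝ) (k : ℕ → ℕ), (∀ n : ℕ, (k n : ℝ) ≤ C * Real.log n ^ 4) ∧
      ∀ (n : ℕ) (M : Matroid (Fin n)), M.E = Set.univ →
        ∃ A : SampleOnlineAlgorithm n (k n) M.indepFamily, A.IsCompetitive (1 / 4 - ε) := by
  obtain ⟨δ, hδ0, hδ1, hδε⟩ : ∃ δ : ℝ, 0 < δ ∧ δ ≤ 1 / 40 ∧ 9 * δ ≤ 4 * ε :=
    ⟨min ε (1 / 4) / 10, by positivity, by linarith [min_le_right ε (1 / 4)],
      by linarith [min_le_left ε (1 / 4)]⟩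
  obtain ⟨k, lam, b, hk, hlam, hb0, hb1, hab, hc⟩ := exists_group_size hδ0 hδ1
  set c := Real.exp (-(lam * (1 + δ))) * b⁻¹ with hcdef
  have hc0 : 0 < c := by positivity
  set r := (1 + δ) / 2 / (1 / 2 + 2 * δ - δ) with hr
  have hr0 : 0 < r := div_pos (by linarith) (by linarith)
  have hr1 : r < 1 := (div_lt_one (by linarith)).2 (by linarith)
  -- `L` makes `r ^ L * n ≤ 1 / 2`, so the last rank is 0; `m` makes `2 * n ^ 2 * c ^ m ≤ δ` for the
  -- union bound over sets.
  obtain ⟨BL, L, hBL, hL⟩ := exists_log_le_exp 2 1 (neg_pos.2 (Real.log_neg hr0 hr1))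
  obtain ⟨Bm, m, hBm, hm⟩ := exists_log_le_exp (2 / δ) 2 (neg_pos.2 (Real.log_neg hc0 hc))
  have hl2 : 0 < Real.log 2 := Real.log_pos one_lt_two
  set BJ := BL / δ + 1 / Real.log 2 with hBJ
  have hBJ0 : 0 ≤ BJ := by positivity
  -- The exponent `2 * δ ^ 2` is Hoeffding's. The power 3 covers the `n` items and the crude bounds
  -- of `L n` and `J n` by multiples of `n`.
  obtain ⟨BT, T, hBT, hT⟩ := exists_log_le_exp (2 * BL * BJ / δ) 3
    (show 0 < 2 * δ ^ 2 by positivity)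
  let J : ℕ → ℕ := fun n => ⌈(L n : ℝ) / δ⌉₊
  have hlog : ∀ n : ℕ, 2 ≤ n → Real.log 2 ≤ Real.log n := fun n hn =>
    Real.log_le_log two_pos (by exact_mod_cast hn)
  have hJ : ∀ n, 2 ≤ n → 0 < J n ∧ (J n : ℝ) ≤ BJ * Real.log n ∧ (L n / J n : ℝ) ≤ δ := by
    intro n hn
    have hL0 : (0 : ℝ) < L n := by exact_mod_cast (hL n hn).1
    have h0 : 0 < J n := Nat.ceil_pos.2 (by positivity)
    refine ⟨h0, ?_, ?_⟩
    · have h1 := (Nat.ceil_lt_add_one (a := (L n : ℝ) / δ) (by positivity)).le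
      have h2 : 1 ≤ 1 / Real.log 2 * Real.log n := by
        rw [one_div_mul_eq_div, one_le_div hl2]; exact hlog n hn
      have h3 : (L n : ℝ) / δ ≤ BL / δ * Real.log n := by
        rw [div_mul_eq_mul_div]
        exact div_le_div_of_nonneg_right (hL n hn).2.1 hδ0.le
      calc (J n : ℝ) ≤ _ := h1
        _ ≤ BL / δ * Real.log n + 1 / Real.log 2 * Real.log n := add_le_add h3 h2
        _ = _ := by rw [hBJ]; ring
    · rw [div_le_iff₀ (by exact_mod_cast h0), ← div_le_iff₀' hδ0]
      exact Nat.le_ceil _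
  -- Since `Real.log 0 = Real.log 1 = 0`, no samples are allowed for `n < 2`. For `n ≥ 2`, dividing
  -- by powers of `Real.log 2` lifts the lower powers of the logarithm to the fourth.
  refine ⟨Bm * k / Real.log 2 ^ 3 + BL * BJ * BT / Real.log 2,
    fun n => if n < 2 then 0 else m n * k + L n * J n * T n, fun n => ?_, fun n M hE => ?_⟩
  · dsimp only
    split_ifs with hn
    · rw [Nat.cast_zero]
      positivity
    · push Not at hn
      have hln := hlog n hn
      have hln0 : 0 < Real.log n := hl2.trans_le hln
      push_cast
      have h1 : (m n : ℝ) * k ≤ Bm * k / Real.log 2 ^ 3 * Real.log n ^ 4 := by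
        calc (m n : ℝ) * k ≤ Bm * Real.log n * k := by gcongr; exact (hm n hn).2.1
          _ = Bm * k / Real.log 2 ^ 3 * (Real.log 2 ^ 3 * Real.log n) := by field_simp
          _ ≤ Bm * k / Real.log 2 ^ 3 * (Real.log n ^ 3 * Real.log n) := by gcongr
          _ = _ := by ring
      have h2 : (L n : ℝ) * J n * T n ≤ BL * BJ * BT / Real.log 2 * Real.log n ^ 4 := by
        calc (L n : ℝ) * J n * T n
            ≤ BL * Real.log n * (BJ * Real.log n) * (BT * Real.log n) := by
              gcongr
              exacts [(hL n hn).2.1, (hJ n hn).2.1, (hT n hn).2.1]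
          _ = BL * BJ * BT / Real.log 2 * (Real.log 2 * Real.log n ^ 3) := by field_simp
          _ ≤ BL * BJ * BT / Real.log 2 * (Real.log n * Real.log n ^ 3) := by gcongr
          _ = _ := by ring
      linarith
  · by_cases hn : n < 2
    · exact ⟨allOrNothing _ M, isCompetitive_allOrNothing hn M (by linarith)⟩
    · have hK : (if n < 2 then 0 else m n * k + L n * J n * T n) = m n * k + L n * J n * T n :=
        if_neg hn
      push Not at hn
      have hn0 : (0 : ℝ) < n := by exact_mod_cast (by omega : 0 < n)
      have := NeZero.of_pos hk
      have := NeZero.of_pos (hm n hn).1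
      have := NeZero.of_pos (hJ n hn).1
      obtain ⟨e⟩ : Nonempty (Fin (if n < 2 then 0 else m n * k + L n * J n * T n) ≃
          (Fin (m n) × Fin k) ⊕ ((Fin (L n) × Fin (J n)) × Fin (T n))) :=
        Fintype.card_eq.1 (by rw [hK]; simp)
      refine ⟨selectionAlgorithm M hE (1 / 2 + 2 * δ) e, isCompetitive_selectionAlgorithm M hE e
        (p := (1 + c ^ m n) ^ n - 1) hδ0 hδ1 hδε (hT n hn).1 ?_ ?_ (hJ n hn).2.2 ?_ ?_
        fun D hD => ?_⟩
      · have h1 := (hL n hn).2.2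
        have h2 : Real.exp (-Real.log r * L n) = (r ^ L n)⁻¹ := by
          rw [← Real.exp_log (pow_pos hr0 (L n)), ← Real.exp_neg, Real.log_pow]
          ring_nf
        rw [h2, pow_one, le_inv_comm₀ (by positivity) (by positivity)] at h1
        rw [← hr]
        calc r ^ L n * n ≤ (2 * (n : ℝ))⁻¹ * n := by gcongr
          _ = 1 / 2 := by field_simp
          _ < 1 := by norm_num
      · have h1 := (hT n hn).2.2
        have hlogn : Real.log n ≤ n := (Real.log_le_sub_one_of_pos hn0).trans (by linarith)
        have hL' : (L n : ℝ) ≤ BL * n := (hL n hn).2.1.trans (by gcongr)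
        have hJ' : (J n : ℝ) ≤ BJ * n := (hJ n hn).2.1.trans (by gcongr)
        rw [Real.exp_neg]
        calc (L n : ℝ) * J n * (n * (2 * (Real.exp (2 * δ ^ 2 * T n))⁻¹))
            ≤ BL * n * (BJ * n) * (n * (2 * (Real.exp (2 * δ ^ 2 * T n))⁻¹)) := by gcongr
          _ = 2 * BL * BJ / δ * n ^ 3 * (Real.exp (2 * δ ^ 2 * T n))⁻¹ * δ := by field_simp
          _ ≤ Real.exp (2 * δ ^ 2 * T n) * (Real.exp (2 * δ ^ 2 * T n))⁻¹ * δ := by gcongr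
          _ = δ := by rw [mul_inv_cancel₀ (Real.exp_pos _).ne', one_mul]
      · have : 1 ≤ (1 + c ^ m n) ^ n := one_le_pow₀ (by linarith [pow_pos hc0 (m n)])
        linarith
      · refine one_add_pow_sub_one_le (by positivity) (by linarith) (by omega) ?_
        have h1 := (hm n hn).2.2
        have h2 : Real.exp (-Real.log c * m n) = (c ^ m n)⁻¹ := by
          rw [← Real.exp_log (pow_pos hc0 (m n)), ← Real.exp_neg, Real.log_pow]
          ring_nf
        rw [h2, ← one_div, le_div_iff₀ (by positivity)] at h1
        calc 2 * (n : ℝ) ^ 2 * c ^ m n = δ * (2 / δ * n ^ 2 * c ^ m n) := by field_simp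
          _ ≤ δ * 1 := by gcongr
          _ = δ := mul_one δ
      · have h1 := measure_not_wellSpread_le (m := m n) (k := k) (D := D) M (δ := δ) hE hlam hb0
          hb1 hab
        rwa [Fintype.card_fin] at h1
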